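/- Consider the plant $\dot z=Az+B\psi(Sz)+Nw$, $y=Cz+\eta$, with state $z\in\mathbb R^{n_z}$, disturbance $w\in\mathbb R^{n_w}$, measurement noise $\eta\in\mathbb R^{n_y}$, and $\psi:\mathbb R^{n_q}\to\mathbb R^{n_s}$ satisfying $|\psi(v_1)-\psi(v_2)|\le \ell|v_1-v_2|$ for all $v_1,v_2$, where $\ell>0$. The output is available only at times $t_1<t_2<\cdots$ with $0\le t_1\le T_2$ and $T_1\le t_{k+1}-t_k\le T_2$, where $0<T_1\le T_2$. For gains $L\in\mathbb R^{n_z\times n_y}$, $H\in\mathbb R^{n_y\times n_y}$ consider the observer $$\dot{\hat z}=A\hat z+B\psi(S\hat z)+L\theta,\quad \dot\theta=H\theta\quad(t\ne t_k),\qquad \hat z^+=\hat z,\quad \theta^+=y-C\hat z\quad(t=t_k).$$ Model the interconnection as a hybrid system with state $x=(z,\hat z,\theta,\tau)$, where the timer $\tau\in[0,T_2]$ satisfies $\dot\tau=-1$, and a jump (a sample) occurs exactly when $\tau=0$, after which $\tau^+\in[T_1,T_2]$ is arbitrary. Hybrid arcs $\phi$ are locally absolutely continuous in $t$, hybrid inputs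 $u=(w,\eta)$ are measurable and locally essentially bounded in $t$, and $(\phi,u)$ is a solution pair if they have the same hybrid time domain and satisfy the dynamics. Let $\varepsilon=z-\hat z$, $\tilde\theta=C\varepsilon-\theta$, let $\mathcal A=\{\varepsilon=0,\ \tilde\theta=0,\ \tau\in[0,T_2]\}$, let $|\cdot|_{\mathcal A}$ be the Euclidean distance to $\mathcal A$, and let $y_p=C_p\varepsilon$. Let $\lambda_t,\gamma>0$. Suppose that there are symmetric positive definite $P_1\in\mathbb R^{n_z\times n_z}$, $P_2\in\mathbb R^{n_y\times n_y}$, reals $\delta,\chi>0$ and matrices $J\in\mathbb R^{n_z\times n_y}$, $Y\in\mathbb R^{n_y\times n_y}$ such that, for both $s=1$ and $s=e^{\delta T_2}$, the symmetric matrix $$\begin{pmatrix}\operatorname{He}(P_1A-JC)+2\lambda_tP_1+C_p^{\mathsf T}C_p+\ell^2\chi S^{\mathsf T}S & J+s(A^{\mathsf T}C^{\mathsf T}P_2-C^{\mathsf T}Y) & P_1N & P_1B\\ \bullet & s(\operatorname{He}(Y)+(2\lambda_t-\delta)P_2) & sP_2CN & sP_2CB\\ \bullet&\bullet&-\gamma^2I&0\\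 \bullet&\bullet&\bullet&-\chi I\end{pmatrix}$$ is negative semidefinite, where $\operatorname{He}(M)=M+M^{\mathsf T}$. Let $L=P_1^{-1}J$ and $H=P_2^{-1}Y^{\mathsf T}-CL$. Then: (P1) For $w\equiv0$, $\eta\equiv0$, every maximal solution is complete, and there is $\kappa>0$ with $|\phi(t,j)|_{\mathcal A}\le\kappa e^{-\lambda_t t}|\phi(0,0)|_{\mathcal A}$ for every solution and every $(t,j)$ in its domain. (P2) The system is exponentially input-to-state stable with respect to $\mathcal A$: there are $\kappa,\lambda>0$ and a class-$\mathcal K$ function $\rho$ with $|\phi(t,j)|_{\mathcal A}\le\max\{\kappa e^{-\lambda(t+j)}|\phi(0,0)|_{\mathcal A},\rho(\|u\|_\infty)\}$ for all solution pairs $(\phi,u)$ with $u\in\mathcal L_\infty$ and all $(t,j)\in\operatorname{dom}\phi$; and every maximal solution pair whose input is essentially bounded on bounded portions of its domain is complete. (P3) There is $\alpha>0$ such that every solution pair with $\eta\equiv0$ satisfies $\|y_p\|_2\le\alpha|\phi(0,0)|_{\mathcal A}+\gamma\|w\|_2$, the $\mathcal L_2$ norms being taken over ordinary time in the domain of the solution.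 Moreover, if $Y=0$, the change of variables $(\hat z,\theta)\mapsto(\hat z,v)=(\hat z,\theta+C\hat z)$ transforms the observer into the predictor-based observer $\dot{\hat z}=A\hat z+B\psi(S\hat z)+L(v-C\hat z)$, $\dot v=C(A\hat z+B\psi(S\hat z))$ between the sampling times, $\hat z^+=\hat z$, $v^+=y$ at the sampling times: $(\phi,u)$ is a solution pair of the interconnection with the former if and only if the transformed pair is one of the interconnection with the latter. -/

import Mathlib

open MeasureTheory Set
open scoped ENNReal

noncomputable section

/-! ### Hybrid time domains, hybrid signals, hybrid arcs, hybrid inputs -/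

/-- A hybrid time domain: the union of a finite or infinite sequence of intervals
`[t j, t (j+1)] × {j}` with `t 0 = 0`, where the last interval, if there is one, may also be of
the form `[t J, T)` with `T` finite or infinite. (It always contains `(0, 0)`.) -/
def IsHybridTimeDomain (E : Set (ℝ × ℕ)) : Prop :=
  ∃ t : ℕ → ℝ, t 0 = 0 ∧ Monotone t ∧
    (E = {p | p.1 ∈ Icc (t p.2) (t (p.2 + 1))} ∨
      ∃ (J : ℕ) (last : Set ℝ),
        (last = Icc (t J) (t (J + 1)) ∨
          (t J < t (J + 1) ∧ last = Ico (t J) (t (J + 1))) ∨ last = Ici (t J)) ∧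
        E = {p | (p.2 < J ∧ p.1 ∈ Icc (t p.2) (t (p.2 + 1))) ∨ (p.2 = J ∧ p.1 ∈ last)})

/-- A hybrid signal: a function on a hybrid time domain. Only the values on the domain matter. -/
structure HybridSignal (E : Type*) where
  dom : Set (ℝ × ℕ)
  val : ℝ → ℕ → E
  isDomain : IsHybridTimeDomain dom

namespace HybridSignal

variable {E F : Type*}

/-- The `j`-th time interval `{t | (t, j) ∈ dom}` of a hybrid signal. -/
def slice (φ : HybridSignal E) (j : ℕ) : Set ℝ := {t | (t, j) ∈ φ.dom}

/-- The projection of the domain on ordinary time. -/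
def domT (φ : HybridSignal E) : Set ℝ := {t | ∃ j, (t, j) ∈ φ.dom}

/-- `j(t) = min {j | (t, j) ∈ dom}`. -/
def jmin (φ : HybridSignal E) (t : ℝ) : ℕ := sInf {j | (t, j) ∈ φ.dom}

/-- The composition of a hybrid signal with a map. -/
def map (g : E → F) (φ : HybridSignal E) : HybridSignal F :=
  ⟨φ.dom, fun t j => g (φ.val t j), φ.isDomain⟩

/-- Completeness: the domain is unbounded. -/
def IsComplete (φ : HybridSignal E) : Prop := ∀ M : ℝ, ∃ p ∈ φ.dom, M ≤ p.1 + p.2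

/-- A hybrid arc: locally absolutely continuous in `t` for each `j`. -/
def IsArc [PseudoMetricSpace E] (φ : HybridSignal E) : Prop :=
  ∀ (j : ℕ) (a b : ℝ), a ≤ b → Icc a b ⊆ φ.slice j →
    AbsolutelyContinuousOnInterval (fun t => φ.val t j) a b

/-- A hybrid input: (Lebesgue) measurable and locally essentially bounded in `t` for each `j`. -/
def IsInput [MeasurableSpace E] [Norm E] (u : HybridSignal E) : Prop :=
  ∀ j : ℕ, AEMeasurable (fun t => u.val t j) (volume.restrict (u.slice j)) ∧
    ∀ K ⊆ u.slice j, IsCompact K → ∃ M : ℝ, ∀ᵐ t ∂(volume.restrict K), ‖u.val t j‖ ≤ M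

/-- The `T`-truncated `L∞` norm: the maximum of the essential supremum over the points
of the domain that are not jump points and the supremum over the jump points, `t + j ≤ T`. -/
def truncSupNorm [NormedAddCommGroup E] (u : HybridSignal E) (T : ℝ) : ℝ≥0∞ :=
  max
    (⨆ k : ℕ, essSup (fun s => ‖u.val s k‖ₑ)
      (volume.restrict {s : ℝ | (s, k) ∈ u.dom ∧ (s, k + 1) ∉ u.dom ∧ s + k ≤ T}))
    (⨆ p ∈ {p : ℝ × ℕ | p ∈ u.dom ∧ (p.1, p.2 + 1) ∈ u.dom ∧ p.1 + p.2 ≤ T}, ‖u.val p.1 p.2‖ₑ)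

/-- The `L∞` norm, the limit of the (monotone) truncated norms. -/
def supNorm [NormedAddCommGroup E] (u : HybridSignal E) : ℝ≥0∞ := ⨆ T : ℝ, u.truncSupNorm T

end HybridSignal

/-! ### Hybrid systems with inputs and their solution pairs -/

/-- A hybrid system with state in `X`, flow input in `W` and jump input in `N`. -/
structure HybridSystem (X W N : Type*) where
  flowSet : Set X
  flowMap : X → W → X
  jumpSet : Set X
  jumpMap : X → N → Set X

/-- The space of inputs `u = (w, η)`, with the Euclidean norm of the pair. -/
abbrev InputPair (W N : Type*) := WithLp 2 (W × N)

namespace HybridSystem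

variable {X W N : Type*} [NormedAddCommGroup X] [NormedSpace ℝ X]
  [NormedAddCommGroup W] [MeasurableSpace W]
  [NormedAddCommGroup N] [MeasurableSpace N]

/-- `(φ, u)` is a solution pair: a hybrid arc and a hybrid input with the same domain, which
start in the closure of the flow set or in the jump set and satisfy the flow and jump dynamics. -/
structure IsSolutionPair (H : HybridSystem X W N) (φ : HybridSignal X)
    (u : HybridSignal (InputPair W N)) : Prop where
  arc : φ.IsArc
  input : u.IsInput
  dom_eq : φ.dom = u.dom
  init : φ.val 0 0 ∈ closure H.flowSet ∪ H.jumpSet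
  flow_mem : ∀ j, ∀ t ∈ interior (φ.slice j), φ.val t j ∈ H.flowSet
  flow : ∀ j, ∀ᵐ t ∂(volume.restrict (φ.slice j)),
    HasDerivAt (fun s => φ.val s j) (H.flowMap (φ.val t j) (u.val t j).fst) t
  jump : ∀ t j, (t, j) ∈ φ.dom → (t, j + 1) ∈ φ.dom →
    φ.val t j ∈ H.jumpSet ∧ φ.val t (j + 1) ∈ H.jumpMap (φ.val t j) (u.val t j).snd

/-- `(φ, u)` is a solution pair with input in the class `𝒰` that has no proper extension to
a solution pair with input in `𝒰`. -/
def IsMaximalIn (H : HybridSystem X W N) (𝒰 : Set (HybridSignal (InputPair W N)))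
    (φ : HybridSignal X) (u : HybridSignal (InputPair W N)) : Prop :=
  H.IsSolutionPair φ u ∧ u ∈ 𝒰 ∧
    ∀ φ' u', H.IsSolutionPair φ' u' → u' ∈ 𝒰 → φ.dom ⊆ φ'.dom →
      (∀ t j, (t, j) ∈ φ.dom → φ'.val t j = φ.val t j ∧ u'.val t j = u.val t j) →
      φ'.dom = φ.dom

/-- Inputs that vanish identically. -/
def zeroInputs (W N : Type*) [NormedAddCommGroup W] [NormedAddCommGroup N] :
    Set (HybridSignal (InputPair W N)) :=
  {u | ∀ t j, (t, j) ∈ u.dom → u.val t j = 0}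

/-- Global exponential stability of `𝒜`, for zero inputs, with rate `rate` with respect to
ordinary time: every maximal solution is complete and the distance to `𝒜` decays. -/
def IsGloballyExpStable (H : HybridSystem X W N) (𝒜 : Set X) (rate : ℝ) : Prop :=
  (∀ φ u, H.IsMaximalIn (zeroInputs W N) φ u → φ.IsComplete) ∧
  ∃ κ > 0, ∀ φ u, H.IsSolutionPair φ u → u ∈ zeroInputs W N → ∀ t j, (t, j) ∈ φ.dom →
    Metric.infDist (φ.val t j) 𝒜 ≤ κ * Real.exp (-rate * t) * Metric.infDist (φ.val 0 0) 𝒜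

/-- Exponential input-to-state stability with respect to `𝒜`: a bound by the maximum of an
exponentially decaying term in `t + j` and a class-`𝒦` function of the `L∞` norm of the input, for
all solution pairs with input in `L∞`; and completeness of every maximal solution pair whose input
is essentially bounded on bounded portions of its domain (in particular, is in `L∞`). -/
def IsExpISS (H : HybridSystem X W N) (𝒜 : Set X) : Prop :=
  (∀ φ u, H.IsMaximalIn univ φ u → (∀ T, u.truncSupNorm T < ∞) → φ.IsComplete) ∧
  ∃ κ > 0, ∃ rate > 0, ∃ ρ : ℝ → ℝ,
    ContinuousOn ρ (Ici 0) ∧ StrictMonoOn ρ (Ici 0) ∧ ρ 0 = 0 ∧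
    ∀ φ u, H.IsSolutionPair φ u → u.supNorm < ∞ → ∀ t j, (t, j) ∈ φ.dom →
      Metric.infDist (φ.val t j) 𝒜 ≤
        max (κ * Real.exp (-rate * (t + j)) * Metric.infDist (φ.val 0 0) 𝒜) (ρ u.supNorm.toReal)

/-- `L₂`-external stability, with gain at most `γ`, from the flow input `w` to the output
`h x`, when the jump input `η` vanishes. (Both norms may be infinite.) -/
def IsL2Stable {P : Type*} [NormedAddCommGroup P] (H : HybridSystem X W N) (h : X → P)
    (𝒜 : Set X) (γ : ℝ) : Prop :=
  ∃ α > 0, ∀ φ u, H.IsSolutionPair φ u → (∀ t j, (t, j) ∈ u.dom → (u.val t j).snd = 0) →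
    eLpNorm (fun s => h (φ.val s (φ.jmin s))) 2 (volume.restrict φ.domT) ≤
      ENNReal.ofReal (α * Metric.infDist (φ.val 0 0) 𝒜) +
      ENNReal.ofReal γ *
        eLpNorm (fun s => (u.val s (u.jmin s)).fst) 2 (volume.restrict u.domT)

end HybridSystem

/-! ### The plant, the observer, and their interconnection -/

abbrev Vec (n : ℕ) := EuclideanSpace ℝ (Fin n)

/-- The action of a matrix on Euclidean vectors. -/
abbrev Matrix.act {m n : ℕ} (M : Matrix (Fin m) (Fin n) ℝ) (v : Vec n) : Vec m :=
  Matrix.toEuclideanLin M v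

/-- The data of the plant `ż = A z + B ψ(S z) + N w`, `y = C z + η`, together with the matrix `Cp`
of the performance output `y_p = Cp (z - ẑ)`. -/
structure PlantData (nz ny nw nq ns np : ℕ) where
  A : Matrix (Fin nz) (Fin nz) ℝ
  B : Matrix (Fin nz) (Fin ns) ℝ
  S : Matrix (Fin nq) (Fin nz) ℝ
  N : Matrix (Fin nz) (Fin nw) ℝ
  C : Matrix (Fin ny) (Fin nz) ℝ
  Cp : Matrix (Fin np) (Fin nz) ℝ
  ψ : Vec nq → Vec ns

/-- The state `(z, ẑ, θ, τ)` of the plant, the observer and the sampling timer, with the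
Euclidean norm of `ℝ^(2 nz + ny + 1)`. -/
abbrev ObsState (nz ny : ℕ) := WithLp 2 (Vec nz × WithLp 2 (Vec nz × WithLp 2 (Vec ny × ℝ)))

namespace ObsState

variable {nz ny : ℕ}

def mk (z zhat : Vec nz) (θ : Vec ny) (τ : ℝ) : ObsState nz ny :=
  WithLp.toLp 2 (z, WithLp.toLp 2 (zhat, WithLp.toLp 2 (θ, τ)))

def z (x : ObsState nz ny) : Vec nz := x.fst
def zhat (x : ObsState nz ny) : Vec nz := x.snd.fst
def θ (x : ObsState nz ny) : Vec ny := x.snd.snd.fst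
def τ (x : ObsState nz ny) : ℝ := x.snd.snd.snd

end ObsState

namespace PlantData

variable {nz ny nw nq ns np : ℕ} (p : PlantData nz ny nw nq ns np)

/-- The right-hand side `A z + B ψ(S z)` of the undisturbed plant. -/
def drift (z : Vec nz) : Vec nz := p.A.act z + p.B.act (p.ψ (p.S.act z))

/-- The plant interconnected with the observer
`ẑ' = A ẑ + B ψ(S ẑ) + L θ`, `θ' = H θ` between the sampling times and
`ẑ⁺ = ẑ`, `θ⁺ = y - C ẑ` at the sampling times, where `y = C z + η`. A timer `τ ∈ [0, T₂]`
decreases at unit rate, triggers a sample when it reaches `0`, and is then reset to an arbitrary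
point of `[T₁, T₂]`: the sampling times are exactly the sequences with `0 ≤ t₁ ≤ T₂` and
`T₁ ≤ t_{k+1} - t_k ≤ T₂`. -/
def withObserver (T₁ T₂ : ℝ) (L : Matrix (Fin nz) (Fin ny) ℝ) (H : Matrix (Fin ny) (Fin ny) ℝ) :
    HybridSystem (ObsState nz ny) (Vec nw) (Vec ny) where
  flowSet := {x | x.τ ∈ Icc 0 T₂}
  flowMap x w := ObsState.mk (p.drift x.z + p.N.act w) (p.drift x.zhat + L.act x.θ) (H.act x.θ) (-1)
  jumpSet := {x | x.τ = 0}
  jumpMap x η := {x' | ∃ v ∈ Icc T₁ T₂,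
    x' = ObsState.mk x.z x.zhat ((p.C.act x.z + η) - p.C.act x.zhat) v}

/-- The set where the estimate is exact: `ẑ = z`, `C (z - ẑ) - θ = 0` (that is, `θ = 0`) and
`τ ∈ [0, T₂]`. -/
def target (T₂ : ℝ) : Set (ObsState nz ny) :=
  {x | x.z - x.zhat = 0 ∧ p.C.act (x.z - x.zhat) - x.θ = 0 ∧ x.τ ∈ Icc 0 T₂}

/-- The performance output `y_p = Cp (z - ẑ)`. -/
def perfOutput (x : ObsState nz ny) : Vec np := p.Cp.act (x.z - x.zhat)

/-- The gains `L` and `H` solve the observer design problem with prescribed convergence rate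
`lam` and prescribed `L₂`-gain `γ`. -/
structure SolvesObserverProblem (T₁ T₂ lam γ : ℝ)
    (L : Matrix (Fin nz) (Fin ny) ℝ) (H : Matrix (Fin ny) (Fin ny) ℝ) : Prop where
  /-- Global exponential stability for zero disturbances, with the prescribed rate. -/
  expStable : (p.withObserver T₁ T₂ L H).IsGloballyExpStable (p.target T₂) lam
  /-- Input-to-state stability: the estimation error is bounded for bounded disturbances. -/
  iss : (p.withObserver T₁ T₂ L H).IsExpISS (p.target T₂)
  /-- `L₂`-external stability from `w` to `y_p` for `η = 0`, with the prescribed gain. -/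
  l2 : (p.withObserver T₁ T₂ L H).IsL2Stable p.perfOutput (p.target T₂) γ

/-- The plant interconnected with the predictor-based observer, with state `(z, ẑ, v, τ)`:
`ẑ' = A ẑ + B ψ(S ẑ) + L (v - C ẑ)`, `v' = C (A ẑ + B ψ(S ẑ))` between the sampling times and
`ẑ⁺ = ẑ`, `v⁺ = y` at the sampling times (`v` predicts the output between samples). -/
def withPredictor (T₁ T₂ : ℝ) (L : Matrix (Fin nz) (Fin ny) ℝ) :
    HybridSystem (ObsState nz ny) (Vec nw) (Vec ny) where
  flowSet := {x | x.τ ∈ Icc 0 T₂}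
  flowMap x w := ObsState.mk (p.drift x.z + p.N.act w)
    (p.drift x.zhat + L.act (x.θ - p.C.act x.zhat)) (p.C.act (p.drift x.zhat)) (-1)
  jumpSet := {x | x.τ = 0}
  jumpMap x η := {x' | ∃ v ∈ Icc T₁ T₂, x' = ObsState.mk x.z x.zhat (p.C.act x.z + η) v}

/-- The change of coordinates `(z, ẑ, θ, τ) ↦ (z, ẑ, θ + C ẑ, τ)`. -/
def predictorCoord (x : ObsState nz ny) : ObsState nz ny :=
  ObsState.mk x.z x.zhat (x.θ + p.C.act x.zhat) x.τ

/-- The matrix of the linear matrix inequalities, with `s` in the place of `e^(δ τ)`. Its blocks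
are indexed by the coordinates of `(ε, θ̃)` and `(w, ζ)`. -/
def lmiMatrix (ℓ lam γ δ χ s : ℝ) (P₁ : Matrix (Fin nz) (Fin nz) ℝ)
    (P₂ : Matrix (Fin ny) (Fin ny) ℝ) (J : Matrix (Fin nz) (Fin ny) ℝ)
    (Y : Matrix (Fin ny) (Fin ny) ℝ) :
    Matrix ((Fin nz ⊕ Fin ny) ⊕ (Fin nw ⊕ Fin ns)) ((Fin nz ⊕ Fin ny) ⊕ (Fin nw ⊕ Fin ns)) ℝ :=
  let M₁₁ := (P₁ * p.A - J * p.C) + (P₁ * p.A - J * p.C).transpose + (2 * lam) • P₁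
    + p.Cp.transpose * p.Cp + (ℓ ^ 2 * χ) • (p.S.transpose * p.S)
  let M₁₂ := J + s • (p.A.transpose * p.C.transpose * P₂ - p.C.transpose * Y)
  let M₂₂ := s • (Y + Y.transpose + (2 * lam - δ) • P₂)
  let R := Matrix.fromBlocks (P₁ * p.N) (P₁ * p.B) (s • (P₂ * p.C * p.N)) (s • (P₂ * p.C * p.B))
  Matrix.fromBlocks (Matrix.fromBlocks M₁₁ M₁₂ M₁₂.transpose M₂₂) R R.transpose
    (Matrix.fromBlocks (-(γ ^ 2) • 1) 0 0 (-χ • 1))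

end PlantData

end

noncomputable section

/-! ### Absolutely continuous functions -/

namespace AbsolutelyContinuousOnInterval

variable {X Y : Type*} [PseudoMetricSpace X] [PseudoMetricSpace Y] {a b c : ℝ}

/-! The proof rests on the function V = ⟪ε, P₁ ε⟫ + e^(δτ) ⟪θ̃, P₂ θ̃⟫ (`lyap`). Since τ decreases
at unit rate during flows, the weight contributes -δ e^(δτ) ⟪θ̃, P₂ θ̃⟫ to the derivative of V. The
choice of H makes L disappear from the equation of θ̃, and after the substitutions J = P₁ L and Yᵀ =
P₂ (H + C L) the derivative becomes a quadratic form in (ε, θ̃, w, ζ), where ζ = ψ(Sz) - ψ(Sẑ) is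
treated as an independent variable constrained by |ζ|² ≤ ℓ²|Sε|². The number χ is the multiplier of
that constraint. The form is affine in s = e^(δτ), so its sign at s = 1 and s = e^(δT₂) decides its
sign for every τ in [0, T₂]. The outcome is V' ≤ -2λ_t V - |y_p|² + γ²|w|² (`lyap_rate`,
`exists_hasDerivAt_lyap`). At a sample ε is unchanged and θ̃⁺ = -η, so V grows by at most a multiple
of |η|² (`lyap_jump_le`).

V is comparable to the squared distance to the target (`exists_infDist_sq_le`, `exists_lyap_le`), so
estimates for V yield the three properties. For stability, a timer-dependent correction subtracted
from V turns the noise-driven jumps into nonincreasing ones (`exists_lyap_solution_le`). Decay in t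
becomes decay in t + j because samples are at least T₁ apart (`jumps_mul_le`). For the gain, the
dissipation inequality is integrated over the domain (`lintegral_perfOutput_le`) and square roots
are taken.

Completeness is proved by extending a solution whose domain is bounded. A half-open last interval is
closed using a Gronwall bound. On a closed one the solution jumps if τ = 0, and flows further if τ >
0. The input is extended by zero, so the flow extension needs only Picard-Lindelöf for an autonomous
Lipschitz field (`isComplete_of_isMaximalIn`).

If Y = 0 then H = -CL, and the change of variables is an invertible linear shear carrying each
system to the other. -/

theorem congr_eqOn {f g : ℝ → X} (hf : AbsolutelyContinuousOnInterval f a b)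
    (hfg : EqOn f g (uIcc a b)) : AbsolutelyContinuousOnInterval g a b := by
  rw [absolutelyContinuousOnInterval_iff] at hf ⊢
  intro ε hε
  obtain ⟨δ, hδ, h⟩ := hf ε hε
  refine ⟨δ, hδ, fun E hE hlt => ?_⟩
  convert h E hE hlt using 1
  refine Finset.sum_congr rfl fun i hi => ?_
  rw [hfg (hE.1 i hi).1, hfg (hE.1 i hi).2]

theorem lipschitzOnWith_comp {f : ℝ → X} {g : X → Y} {K : NNReal} {s : Set X}
    (hf : AbsolutelyContinuousOnInterval f a b) (hg : LipschitzOnWith K g s)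
    (hs : MapsTo f (uIcc a b) s) : AbsolutelyContinuousOnInterval (fun t => g (f t)) a b := by
  rw [absolutelyContinuousOnInterval_iff] at hf ⊢
  intro ε hε
  -- Dividing by K + 1 rather than K covers K = 0.
  obtain ⟨δ, hδ, h⟩ := hf (ε / (K + 1)) (by positivity)
  refine ⟨δ, hδ, fun E hE hlt => ?_⟩
  have hK : (0 : ℝ) < K + 1 := by positivity
  calc ∑ i ∈ Finset.range E.1, dist (g (f (E.2 i).1)) (g (f (E.2 i).2))
      ≤ ∑ i ∈ Finset.range E.1, K * dist (f (E.2 i).1) (f (E.2 i).2) :=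
        Finset.sum_le_sum fun i hi => by
          exact hg.dist_le_mul _ (hs (hE.1 i hi).1) _ (hs (hE.1 i hi).2)
    _ ≤ (K + 1) * ∑ i ∈ Finset.range E.1, dist (f (E.2 i).1) (f (E.2 i).2) := by
        rw [← Finset.mul_sum]
        gcongr
        simp
    _ < (K + 1) * (ε / (K + 1)) := by gcongr; exact h E hE hlt
    _ = ε := by field_simp

theorem contDiff_comp {E F : Type*} [NormedAddCommGroup E] [NormedSpace ℝ E]
    [NormedAddCommGroup F] [NormedSpace ℝ F] {f : ℝ → E} {g : E → F}
    (hf : AbsolutelyContinuousOnInterval f a b) (hg : ContDiff ℝ 1 g) :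
    AbsolutelyContinuousOnInterval (fun t => g (f t)) a b := by
  have hK : IsCompact (f '' uIcc a b) := isCompact_uIcc.image_of_continuousOn hf.continuousOn
  obtain ⟨K, hK⟩ := hg.locallyLipschitz.locallyLipschitzOn.exists_lipschitzOnWith_of_compact hK
  exact hf.lipschitzOnWith_comp hK (mapsTo_image _ _)

/-- The map m sends disjoint intervals to disjoint intervals and does not lengthen them, so every
admissible family for the composite is admissible for f. It is used for the truncations `min · b`
and `max · b`. -/
theorem monotone_comp {f : ℝ → X} {m : ℝ → ℝ} {a' b' : ℝ}
    (hf : AbsolutelyContinuousOnInterval f a b) (hmaps : MapsTo m (uIcc a' b') (uIcc a b))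
    (hlip : LipschitzWith 1 m) (hsub : ∀ x y, uIoc (m x) (m y) ⊆ uIoc x y) :
    AbsolutelyContinuousOnInterval (fun t => f (m t)) a' b' := by
  rw [absolutelyContinuousOnInterval_iff] at hf ⊢
  intro ε hε
  obtain ⟨δ, hδ, h⟩ := hf ε hε
  refine ⟨δ, hδ, fun E hE hlt => ?_⟩
  refine h (E.1, fun i => (m (E.2 i).1, m (E.2 i).2)) ⟨fun i hi => ?_, ?_⟩ ?_
  · exact ⟨hmaps (hE.1 i hi).1, hmaps (hE.1 i hi).2⟩
  · exact hE.2.mono fun i => hsub _ _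
  · refine lt_of_le_of_lt (Finset.sum_le_sum fun i _ => ?_) hlt
    simpa using hlip.dist_le_mul (E.2 i).1 (E.2 i).2

/-- Concatenation of absolutely continuous functions. -/
theorem glue {E : Type*} [NormedAddCommGroup E] [NormedSpace ℝ E] {f g : ℝ → E}
    (hf : AbsolutelyContinuousOnInterval f a b) (hg : AbsolutelyContinuousOnInterval g b c)
    (hab : a ≤ b) (hbc : b ≤ c) (hfg : f b = g b) :
    AbsolutelyContinuousOnInterval (fun t => if t ≤ b then f t else g t) a c := by
  have h₁ : AbsolutelyContinuousOnInterval (fun t => f (min t b)) a c := by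
    refine hf.monotone_comp (fun t ht => ?_) (LipschitzWith.id.min_const b) fun x y => ?_
    · rw [uIcc_of_le (hab.trans hbc)] at ht
      rw [uIcc_of_le hab]
      exact ⟨le_min ht.1 hab, min_le_right _ _⟩
    · grind [uIoc]
  have h₂ : AbsolutelyContinuousOnInterval (fun t => g (max t b)) a c := by
    refine hg.monotone_comp (fun t ht => ?_) (LipschitzWith.id.max_const b) fun x y => ?_
    · rw [uIcc_of_le (hab.trans hbc)] at ht
      rw [uIcc_of_le hbc]
      exact ⟨le_max_right _ _, max_le ht.2 hbc⟩
    · grind [uIoc]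
  have h₃ : AbsolutelyContinuousOnInterval (fun _ : ℝ => f b) a c :=
    contDiffOn_const.absolutelyContinuousOnInterval
  -- The glued function equals f(min t b) + g(max t b) - f(b), a combination of absolutely
  -- continuous functions.
  refine ((h₁.add h₂).sub h₃).congr_eqOn fun t _ => ?_
  by_cases ht : t ≤ b
  · simp [ht, hfg]
  · simp [ht, (not_le.mp ht).le]

/-- Absolute continuity gives the fundamental theorem of calculus, so the sign of the derivative is
needed only almost everywhere. -/
theorem le_of_ae_hasDerivAt_nonpos {f : ℝ → ℝ} (hf : AbsolutelyContinuousOnInterval f a b)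
    (hab : a ≤ b) (hd : ∀ᵐ t ∂(volume.restrict (Icc a b)), ∃ d ≤ 0, HasDerivAt f d t) :
    f b ≤ f a := by
  have h := hf.integral_deriv_eq_sub
  have h₂ : ∫ x in a..b, deriv f x ≤ 0 := by
    rw [intervalIntegral.integral_of_le hab]
    refine integral_nonpos_of_ae ?_
    have := ae_mono (Measure.restrict_mono Ioc_subset_Icc_self le_rfl) hd
    filter_upwards [this] with t ⟨d, hd, ht⟩
    rwa [ht.deriv]
  linarith

end AbsolutelyContinuousOnInterval

/-! ### Hybrid time domains -/

namespace IsHybridTimeDomain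

variable {D : Set (ℝ × ℕ)}

theorem zero_mem (hD : IsHybridTimeDomain D) : ((0 : ℝ), 0) ∈ D := by
  obtain ⟨t, h0, hmono, rfl | ⟨J, last, hlast, rfl⟩⟩ := hD
  · exact ⟨h0.le, h0 ▸ hmono (Nat.zero_le _)⟩
  · rcases Nat.eq_zero_or_pos J with rfl | hJ
    · refine Or.inr ⟨rfl, ?_⟩
      rcases hlast with rfl | ⟨hlt, rfl⟩ | rfl
      · exact ⟨h0.le, h0 ▸ hmono (Nat.zero_le _)⟩
      · exact ⟨h0.le, h0 ▸ hlt⟩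
      · exact h0.le
    · exact Or.inl ⟨hJ, h0.le, h0 ▸ hmono (Nat.zero_le _)⟩

theorem ordConnected (hD : IsHybridTimeDomain D) (j : ℕ) :
    OrdConnected {t : ℝ | (t, j) ∈ D} := by
  obtain ⟨t, h0, hmono, rfl | ⟨J, last, hlast, rfl⟩⟩ := hD
  · exact (ordConnected_Icc : OrdConnected (Icc (t j) (t (j + 1))))
  · rcases lt_trichotomy j J with h | rfl | h
    · simpa [h, h.ne] using! (ordConnected_Icc : OrdConnected (Icc (t j) (t (j + 1))))
    · have : OrdConnected last := by
        rcases hlast with rfl | ⟨-, rfl⟩ | rfl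
        · exact ordConnected_Icc
        · exact ordConnected_Ico
        · exact ordConnected_Ici
      simpa using! this
    · simpa [h.ne', h.not_gt] using! (ordConnected_empty : OrdConnected (∅ : Set ℝ))

/-- The slices are attached to one another: if the `(j + 1)`-st slice is nonempty, then it has a
least element, which is also the greatest element of the `j`-th slice. -/
theorem exists_jump_time (hD : IsHybridTimeDomain D) {t : ℝ} {j : ℕ} (ht : (t, j + 1) ∈ D) :
    ∃ s ≤ t, (s, j) ∈ D ∧ (s, j + 1) ∈ D ∧ (∀ r, (r, j) ∈ D → r ≤ s) ∧
      ∀ r, (r, j + 1) ∈ D → s ≤ r := by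
  obtain ⟨T, h0, hmono, rfl | ⟨J, last, hlast, rfl⟩⟩ := hD
  · exact ⟨T (j + 1), ht.1, ⟨hmono (Nat.le_succ _), le_rfl⟩, ⟨le_rfl, hmono (Nat.le_succ _)⟩,
      fun r hr => hr.2, fun r hr => hr.1⟩
  · have hJ : j < J := by rcases ht with ⟨h, -⟩ | ⟨h, -⟩ <;> simp at h <;> omega
    have hlast' : T J ∈ last ∧ ∀ r ∈ last, T J ≤ r := by
      rcases hlast with rfl | ⟨hlt, rfl⟩ | rfl
      · exact ⟨⟨le_rfl, hmono (Nat.le_succ _)⟩, fun r hr => hr.1⟩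
      · exact ⟨⟨le_rfl, hlt⟩, fun r hr => hr.1⟩
      · exact ⟨mem_Ici.mpr le_rfl, fun r hr => hr⟩
    have key : ∀ r, (r, j + 1) ∈ {p : ℝ × ℕ | (p.2 < J ∧ p.1 ∈ Icc (T p.2) (T (p.2 + 1))) ∨
        (p.2 = J ∧ p.1 ∈ last)} → T (j + 1) ≤ r := by
      rintro r (⟨-, h⟩ | ⟨h, h'⟩)
      · exact h.1
      · simp only at h; subst h; exact hlast'.2 r h'
    refine ⟨T (j + 1), key t ht, Or.inl ⟨hJ, hmono (Nat.le_succ _), le_rfl⟩, ?_, ?_, key⟩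
    · rcases Nat.lt_or_ge (j + 1) J with h | h
      · exact Or.inl ⟨h, le_rfl, hmono (Nat.le_succ _)⟩
      · obtain rfl : j + 1 = J := by omega
        exact Or.inr ⟨rfl, hlast'.1⟩
    · rintro r (⟨-, h⟩ | ⟨h, -⟩)
      · exact h.2
      · simp only at h; omega

theorem nonneg (hD : IsHybridTimeDomain D) {t : ℝ} {j : ℕ} (ht : (t, j) ∈ D) : 0 ≤ t := by
  have hz : ∀ r, (r, 0) ∈ D → 0 ≤ r := by
    obtain ⟨T, h0, hmono, rfl | ⟨J, last, hlast, rfl⟩⟩ := hD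
    · exact fun r hr => h0 ▸ hr.1
    · rintro r (⟨-, h⟩ | ⟨h, h'⟩)
      · exact h0 ▸ h.1
      · simp only at h; subst h
        rcases hlast with rfl | ⟨hlt, rfl⟩ | rfl
        · exact h0 ▸ h'.1
        · exact h0 ▸ h'.1
        · exact h0 ▸ h'
  induction j generalizing t with
  | zero => exact hz t ht
  | succ j ih =>
    obtain ⟨s, hst, hs, -⟩ := hD.exists_jump_time ht
    exact (ih hs).trans hst

/-- Induction along a hybrid time domain. -/
theorem induction (hD : IsHybridTimeDomain D) {P : ℝ → ℕ → Prop} (zero : P 0 0)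
    (flow : ∀ j a b, a ≤ b → (a, j) ∈ D → (b, j) ∈ D → P a j → P b j)
    (jump : ∀ t j, (t, j) ∈ D → (t, j + 1) ∈ D → P t j → P t (j + 1))
    {t : ℝ} {j : ℕ} (ht : (t, j) ∈ D) : P t j := by
  induction j generalizing t with
  | zero => exact flow 0 0 t (hD.nonneg ht) hD.zero_mem ht zero
  | succ j ih =>
    obtain ⟨s, hst, hs, hs', -⟩ := hD.exists_jump_time ht
    exact flow (j + 1) s t hst hs' ht (jump s j hs hs' (ih hs))

end IsHybridTimeDomain

namespace HybridSignal

variable {E : Type*} (φ : HybridSignal E)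

theorem Icc_subset_slice {j : ℕ} {a b : ℝ} (ha : (a, j) ∈ φ.dom) (hb : (b, j) ∈ φ.dom) :
    Icc a b ⊆ φ.slice j :=
  (φ.isDomain.ordConnected j).out ha hb

theorem measurableSet_slice (j : ℕ) : MeasurableSet (φ.slice j) :=
  (φ.isDomain.ordConnected j).measurableSet

/-- A slice is an interval, and the frontier of a convex set is null. -/
theorem ae_mem_interior_slice (j : ℕ) :
    ∀ᵐ t ∂(volume.restrict (φ.slice j)), t ∈ interior (φ.slice j) := by
  have hc : Convex ℝ (φ.slice j) := (φ.isDomain.ordConnected j).convex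
  rw [ae_restrict_iff' (φ.measurableSet_slice j)]
  have h0 : volume (frontier (φ.slice j)) = 0 := hc.addHaar_frontier volume
  filter_upwards [measure_eq_zero_iff_ae_notMem.mp h0] with t ht hts
  by_contra hi
  exact ht ⟨subset_closure hts, hi⟩

/-- A hybrid function that is absolutely continuous and satisfies `g' ≤ -a g` during flows, and
does not increase at jumps, decays exponentially. -/
theorem exp_decay {g : ℝ → ℕ → ℝ} (a : ℝ)
    (hac : ∀ j s t, s ≤ t → Icc s t ⊆ φ.slice j →
      AbsolutelyContinuousOnInterval (fun r => g r j) s t)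
    (hflow : ∀ j, ∀ᵐ t ∂(volume.restrict (φ.slice j)),
      ∃ d ≤ -a * g t j, HasDerivAt (fun r => g r j) d t)
    (hjump : ∀ t j, (t, j) ∈ φ.dom → (t, j + 1) ∈ φ.dom → g t (j + 1) ≤ g t j)
    {t : ℝ} {j : ℕ} (ht : (t, j) ∈ φ.dom) : g t j ≤ Real.exp (-a * t) * g 0 0 := by
  suffices h : Real.exp (a * t) * g t j ≤ g 0 0 by
    calc g t j = Real.exp (-a * t) * (Real.exp (a * t) * g t j) := by
          rw [← mul_assoc, ← Real.exp_add]; simp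
      _ ≤ _ := by gcongr
  refine φ.isDomain.induction (P := fun t j => Real.exp (a * t) * g t j ≤ g 0 0) (by simp)
    (fun j s t hst hs ht h => le_trans ?_ h) (fun t j ht ht' h => le_trans ?_ h) ht
  · have hsub := φ.Icc_subset_slice hs ht
    have hexp : AbsolutelyContinuousOnInterval (fun r => Real.exp (a * r)) s t :=
      ContDiff.contDiffOn (by fun_prop) |>.absolutelyContinuousOnInterval
    refine (hexp.mul (hac j s t hst hsub)).le_of_ae_hasDerivAt_nonpos hst ?_
    filter_upwards [ae_mono (Measure.restrict_mono hsub le_rfl) (hflow j)] with r ⟨d, hd, hr⟩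
    have he : HasDerivAt (fun r => Real.exp (a * r)) (Real.exp (a * r) * a) r := by
      simpa using ((hasDerivAt_id r).const_mul a).exp
    refine ⟨_, ?_, he.mul hr⟩
    have := mul_le_mul_of_nonneg_left hd (Real.exp_pos (a * r)).le
    nlinarith
  · exact mul_le_mul_of_nonneg_left (hjump t j ht ht') (Real.exp_pos _).le

end HybridSignal

/-! ### Matrices acting on Euclidean vectors -/

namespace Matrix

variable {k m n : ℕ}

/-- The action of a matrix on Euclidean vectors, as a continuous linear map. -/
def actL (M : Matrix (Fin m) (Fin n) ℝ) : Vec n →L[ℝ] Vec m :=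
  LinearMap.toContinuousLinearMap (Matrix.toEuclideanLin M)

theorem norm_act_le (M : Matrix (Fin m) (Fin n) ℝ) (v : Vec n) : ‖M.act v‖ ≤ ‖M.actL‖ * ‖v‖ :=
  M.actL.le_opNorm v

theorem ofLp_act (M : Matrix (Fin m) (Fin n) ℝ) (v : Vec n) :
    (M.act v).ofLp = M.mulVec v.ofLp := rfl

theorem act_mul (M : Matrix (Fin k) (Fin m) ℝ) (N : Matrix (Fin m) (Fin n) ℝ) (v : Vec n) :
    (M * N).act v = M.act (N.act v) := by
  apply WithLp.ofLp_injective
  simp only [ofLp_act, mulVec_mulVec]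

theorem act_sub (M N : Matrix (Fin m) (Fin n) ℝ) (v : Vec n) :
    (M - N).act v = M.act v - N.act v := by
  simp [act]

theorem act_vec_add (M : Matrix (Fin m) (Fin n) ℝ) (v w : Vec n) :
    M.act (v + w) = M.act v + M.act w := map_add _ _ _

theorem act_vec_sub (M : Matrix (Fin m) (Fin n) ℝ) (v w : Vec n) :
    M.act (v - w) = M.act v - M.act w := map_sub _ _ _

theorem act_one (v : Vec n) : (1 : Matrix (Fin n) (Fin n) ℝ).act v = v := by
  apply WithLp.ofLp_injective
  simp only [ofLp_act, one_mulVec]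

theorem inner_eq_dotProduct (x y : Vec n) : inner ℝ x y = x.ofLp ⬝ᵥ y.ofLp := by
  rw [EuclideanSpace.inner_eq_star_dotProduct, star_trivial, dotProduct_comm]

theorem dotProduct_transpose_mulVec_left (M : Matrix (Fin m) (Fin n) ℝ) (x : Fin n → ℝ)
    (y : Fin m → ℝ) : x ⬝ᵥ (M.transpose.mulVec y) = (M.mulVec x) ⬝ᵥ y := by
  rw [dotProduct_mulVec, vecMul_transpose]

theorem inner_transpose_act (M : Matrix (Fin m) (Fin n) ℝ) (x : Vec n) (y : Vec m) :
    inner ℝ x (M.transpose.act y) = inner ℝ (M.act x) y := by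
  simp only [inner_eq_dotProduct, ofLp_act, dotProduct_transpose_mulVec_left]

theorem PosDef.transpose_eq {P : Matrix (Fin n) (Fin n) ℝ} (hP : P.PosDef) : P.transpose = P := by
  have := hP.isHermitian
  rwa [IsHermitian, conjTranspose_eq_transpose_of_trivial] at this

theorem PosDef.inner_act_comm {P : Matrix (Fin n) (Fin n) ℝ} (hP : P.PosDef) (x y : Vec n) :
    inner ℝ x (P.act y) = inner ℝ (P.act x) y := by
  rw [← inner_transpose_act, hP.transpose_eq]

theorem PosDef.act_inv_act {P : Matrix (Fin n) (Fin n) ℝ} (hP : P.PosDef)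
    (M : Matrix (Fin n) (Fin m) ℝ) (v : Vec m) : P.act ((P⁻¹ * M).act v) = M.act v := by
  have := hP.isUnit
  rw [← act_mul, mul_nonsing_inv_cancel_left]
  rwa [← isUnit_iff_isUnit_det]

/-- Write P = RᵀR. Then ⟪v, P v⟫ = |R v|², and v = P⁻¹Rᵀ(R v) recovers v boundedly from R v, with no
appeal to eigenvalues. -/
theorem PosDef.exists_norm_sq_le {P : Matrix (Fin n) (Fin n) ℝ} (hP : P.PosDef) :
    ∃ K > 0, ∀ v : Vec n, ‖v‖ ^ 2 ≤ K * inner ℝ v (P.act v) := by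
  have hu : IsUnit P.det := (isUnit_iff_isUnit_det P).mp hP.isUnit
  obtain ⟨R, hR⟩ : ∃ R : Matrix (Fin n) (Fin n) ℝ, P = R.transpose * R := by
    open scoped MatrixOrder in
    obtain ⟨R, hR⟩ := CStarAlgebra.nonneg_iff_eq_star_mul_self.mp hP.posSemidef.nonneg
    exact ⟨R, by rw [hR, star_eq_conjTranspose, conjTranspose_eq_transpose_of_trivial]⟩
  have hinner : ∀ v : Vec n, inner ℝ v (P.act v) = ‖R.act v‖ ^ 2 := fun v => by
    rw [hR, act_mul, inner_transpose_act, real_inner_self_eq_norm_sq]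
  refine ⟨‖(P⁻¹ * R.transpose).actL‖ ^ 2 + 1, by positivity, fun v => ?_⟩
  have h₁ : (P⁻¹ * R.transpose).act (R.act v) = v := by
    rw [← act_mul, mul_assoc, ← hR, nonsing_inv_mul _ hu, act_one]
  have h₂ := norm_act_le (P⁻¹ * R.transpose) (R.act v)
  rw [h₁] at h₂
  rw [hinner]
  calc ‖v‖ ^ 2 ≤ (‖(P⁻¹ * R.transpose).actL‖ * ‖R.act v‖) ^ 2 := by gcongr
    _ = ‖(P⁻¹ * R.transpose).actL‖ ^ 2 * ‖R.act v‖ ^ 2 := by ring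
    _ ≤ _ := by gcongr; simp

theorem inner_act_le (P : Matrix (Fin n) (Fin n) ℝ) (v : Vec n) :
    inner ℝ v (P.act v) ≤ ‖P.actL‖ * ‖v‖ ^ 2 :=
  calc inner ℝ v (P.act v) ≤ ‖v‖ * ‖P.act v‖ := real_inner_le_norm _ _
    _ ≤ ‖v‖ * (‖P.actL‖ * ‖v‖) := by gcongr; exact norm_act_le _ _
    _ = _ := by ring

end Matrix

theorem hasDerivAt_weighted_inner {E F : Type*} [NormedAddCommGroup E] [InnerProductSpace ℝ E]
    [NormedAddCommGroup F] [InnerProductSpace ℝ F] {P : E →L[ℝ] E} {Q : F →L[ℝ] F}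
    (hP : ∀ u v, inner ℝ u (P v) = inner ℝ (P u) v) (hQ : ∀ u v, inner ℝ u (Q v) = inner ℝ (Q u) v)
    (δ : ℝ) {e : ℝ → E} {f : ℝ → F} {τ : ℝ → ℝ} {e' : E} {f' : F} {τ' t : ℝ}
    (he : HasDerivAt e e' t) (hf : HasDerivAt f f' t) (hτ : HasDerivAt τ τ' t) :
    HasDerivAt (fun s => inner ℝ (e s) (P (e s)) +
        Real.exp (δ * τ s) * inner ℝ (f s) (Q (f s)))
      (2 * inner ℝ (P (e t)) e' + Real.exp (δ * τ t) *
        (2 * inner ℝ (Q (f t)) f' + δ * τ' * inner ℝ (f t) (Q (f t)))) t := by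
  have h := (he.inner ℝ (P.hasFDerivAt.comp_hasDerivAt t he)).add
    ((hτ.const_mul δ).exp.mul (hf.inner ℝ (Q.hasFDerivAt.comp_hasDerivAt t hf)))
  refine h.congr_deriv ?_
  simp only [Function.comp]
  rw [hP (e t) e', hQ (f t) f', real_inner_comm (P (e t)) e', real_inner_comm (Q (f t)) f']
  ring

/-! ### The linear coordinates of the state space -/

theorem NormedSpace.continuousSMul {E : Type*} [NormedAddCommGroup E] [NormedSpace ℝ E] :
    ContinuousSMul ℝ E := inferInstance

namespace ObsState

variable {nz ny : ℕ}

/-- A shortcut: the general search for this instance is slow. -/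
instance continuousSMul : ContinuousSMul ℝ (ObsState nz ny) := NormedSpace.continuousSMul

def zL : ObsState nz ny →L[ℝ] Vec nz := WithLp.fstL 2 ℝ _ _
def zhatL : ObsState nz ny →L[ℝ] Vec nz := (WithLp.fstL 2 ℝ _ _).comp (WithLp.sndL 2 ℝ _ _)
def θL : ObsState nz ny →L[ℝ] Vec ny :=
  ((WithLp.fstL 2 ℝ _ _).comp (WithLp.sndL 2 ℝ _ _)).comp (WithLp.sndL 2 ℝ _ _)
def τL : ObsState nz ny →L[ℝ] ℝ :=
  ((WithLp.sndL 2 ℝ _ _).comp (WithLp.sndL 2 ℝ _ _)).comp (WithLp.sndL 2 ℝ _ _)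

/-- The estimation error `ε = z - ẑ`. -/
def err : ObsState nz ny →L[ℝ] Vec nz := zL - zhatL

theorem err_apply (x : ObsState nz ny) : err x = x.z - x.zhat := rfl

theorem norm_mk_sq (z zhat : Vec nz) (θ : Vec ny) (τ : ℝ) :
    ‖mk z zhat θ τ‖ ^ 2 = ‖z‖ ^ 2 + (‖zhat‖ ^ 2 + (‖θ‖ ^ 2 + ‖τ‖ ^ 2)) := by
  simp only [mk, WithLp.prod_norm_sq_eq_of_L2, WithLp.toLp_fst, WithLp.toLp_snd]

end ObsState

/-! ### The Lyapunov function and its dissipation inequality -/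

namespace PlantData

variable {nz ny nw nq ns np : ℕ} (p : PlantData nz ny nw nq ns np)

/-- The output error `θ̃ = C ε - θ`. -/
def outErr : ObsState nz ny →L[ℝ] Vec ny := p.C.actL.comp ObsState.err - ObsState.θL

theorem outErr_apply (x : ObsState nz ny) :
    p.outErr x = p.C.act (x.z - x.zhat) - x.θ := rfl

/-- The Lyapunov function `⟪ε, P₁ ε⟫ + e^(δ τ) ⟪θ̃, P₂ θ̃⟫`. -/
def lyap (P₁ : Matrix (Fin nz) (Fin nz) ℝ) (P₂ : Matrix (Fin ny) (Fin ny) ℝ) (δ : ℝ)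
    (x : ObsState nz ny) : ℝ :=
  inner ℝ (ObsState.err x) (P₁.actL (ObsState.err x)) +
    Real.exp (δ * ObsState.τL x) * inner ℝ (p.outErr x) (P₂.actL (p.outErr x))

theorem contDiff_lyap (P₁ : Matrix (Fin nz) (Fin nz) ℝ) (P₂ : Matrix (Fin ny) (Fin ny) ℝ)
    (δ : ℝ) : ContDiff ℝ 1 (p.lyap P₁ P₂ δ) := by
  unfold lyap
  have h₁ : ContDiff ℝ 1 (ObsState.err (nz := nz) (ny := ny)) := ContinuousLinearMap.contDiff _
  have h₂ : ContDiff ℝ 1 p.outErr := ContinuousLinearMap.contDiff _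
  have h₃ : ContDiff ℝ 1 (ObsState.τL (nz := nz) (ny := ny)) := ContinuousLinearMap.contDiff _
  exact (h₁.inner ℝ (P₁.actL.contDiff.comp h₁)).add
    ((contDiff_const.mul h₃).exp.mul (h₂.inner ℝ (P₂.actL.contDiff.comp h₂)))

variable {ℓ lam γ δ χ : ℝ} {P₁ : Matrix (Fin nz) (Fin nz) ℝ} {P₂ : Matrix (Fin ny) (Fin ny) ℝ}
  {J : Matrix (Fin nz) (Fin ny) ℝ} {Y : Matrix (Fin ny) (Fin ny) ℝ}

open Matrix in
/-- The quadratic inequality expressed by the linear matrix inequality. -/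
theorem lmi_quadratic (hP₁ : P₁.PosDef) (hP₂ : P₂.PosDef) {s : ℝ}
    (h : (-p.lmiMatrix ℓ lam γ δ χ s P₁ P₂ J Y).PosSemidef)
    (e : Vec nz) (θ : Vec ny) (w : Vec nw) (ζ : Vec ns) :
    2 * inner ℝ (P₁.act e) (p.A.act e) - 2 * inner ℝ e (J.act (p.C.act e))
      + 2 * lam * inner ℝ e (P₁.act e) + ‖p.Cp.act e‖ ^ 2 + ℓ ^ 2 * χ * ‖p.S.act e‖ ^ 2
      + 2 * inner ℝ e (J.act θ) + 2 * inner ℝ (P₁.act e) (p.N.act w)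
      + 2 * inner ℝ (P₁.act e) (p.B.act ζ) - γ ^ 2 * ‖w‖ ^ 2 - χ * ‖ζ‖ ^ 2
      + s * (2 * inner ℝ (P₂.act θ) (p.C.act (p.A.act e)) - 2 * inner ℝ (Y.act θ) (p.C.act e)
        + 2 * inner ℝ (Y.act θ) θ + (2 * lam - δ) * inner ℝ θ (P₂.act θ)
        + 2 * inner ℝ (P₂.act θ) (p.C.act (p.N.act w))
        + 2 * inner ℝ (P₂.act θ) (p.C.act (p.B.act ζ))) ≤ 0 := by
  -- The block matrix is tested on the stacked vector (ε, θ̃, w, ζ); the rest moves transposes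
  -- across dot products and uses the symmetry of P₁ and P₂. The variable `θ` fills the slot of θ̃.
  have h := h.dotProduct_mulVec_nonneg
    (Sum.elim (Sum.elim e.ofLp θ.ofLp) (Sum.elim w.ofLp ζ.ofLp))
  rw [star_trivial, neg_mulVec, dotProduct_neg, neg_nonneg] at h
  refine le_of_eq_of_le ?_ h
  have h₁ : ∀ v : Fin nz → ℝ, e.ofLp ⬝ᵥ P₁ *ᵥ v = P₁ *ᵥ e.ofLp ⬝ᵥ v := fun v => by
    rw [← dotProduct_transpose_mulVec_left, hP₁.transpose_eq]
  have h₂ : ∀ v : Fin ny → ℝ, θ.ofLp ⬝ᵥ P₂ *ᵥ v = P₂ *ᵥ θ.ofLp ⬝ᵥ v := fun v => by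
    rw [← dotProduct_transpose_mulVec_left, hP₂.transpose_eq]
  simp only [← real_inner_self_eq_norm_sq, inner_eq_dotProduct, ofLp_act, lmiMatrix,
    fromBlocks_mulVec, Sum.elim_comp_inl, Sum.elim_comp_inr,
    dotProduct_add, sumElim_dotProduct_sumElim, fromBlocks_transpose,
    Matrix.add_mulVec, Matrix.sub_mulVec, Matrix.smul_mulVec, transpose_add, transpose_sub,
    transpose_mul, transpose_smul, ← mulVec_mulVec, dotProduct_transpose_mulVec_left,
    dotProduct_sub, dotProduct_smul, transpose_transpose, Matrix.one_mulVec,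
    Matrix.zero_mulVec, dotProduct_zero, hP₁.transpose_eq, hP₂.transpose_eq, smul_eq_mul, h₁, h₂]
  rw [dotProduct_comm (J *ᵥ p.C *ᵥ e.ofLp), dotProduct_comm (p.A *ᵥ e.ofLp),
    dotProduct_comm (J *ᵥ θ.ofLp), dotProduct_comm (p.C *ᵥ p.A *ᵥ e.ofLp),
    dotProduct_comm (p.C *ᵥ e.ofLp), dotProduct_comm (p.N *ᵥ w.ofLp),
    dotProduct_comm (p.B *ᵥ ζ.ofLp), dotProduct_comm (p.C *ᵥ p.N *ᵥ w.ofLp),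
    dotProduct_comm (p.C *ᵥ p.B *ᵥ ζ.ofLp), dotProduct_comm θ.ofLp]
  ring

/-- The derivative of the Lyapunov function along the flow. -/
theorem lyap_rate (hψ : ∀ v₁ v₂ : Vec nq, ‖p.ψ v₁ - p.ψ v₂‖ ≤ ℓ * ‖v₁ - v₂‖)
    (hP₁ : P₁.PosDef) (hP₂ : P₂.PosDef) (hχ : 0 < χ) {s₁ : ℝ}
    (hLMI₀ : (-p.lmiMatrix ℓ lam γ δ χ 1 P₁ P₂ J Y).PosSemidef)
    (hLMI₁ : (-p.lmiMatrix ℓ lam γ δ χ s₁ P₁ P₂ J Y).PosSemidef)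
    {s : ℝ} (hs : s ∈ Icc 1 s₁) (z zhat : Vec nz) (e' : Vec nz) (θ η η' : Vec ny) (w : Vec nw)
    (hη : η = p.C.act (z - zhat) - θ)
    (he' : e' = p.drift z + p.N.act w - (p.drift zhat + (P₁⁻¹ * J).act θ))
    (hη' : η' = p.C.act e' - (P₂⁻¹ * Y.transpose - p.C * (P₁⁻¹ * J)).act θ) :
    2 * inner ℝ (P₁.act (z - zhat)) e' + s * (2 * inner ℝ (P₂.act η) η' - δ * inner ℝ η (P₂.act η))
      ≤ -(2 * lam) * (inner ℝ (z - zhat) (P₁.act (z - zhat)) + s * inner ℝ η (P₂.act η))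
        - ‖p.Cp.act (z - zhat)‖ ^ 2 + γ ^ 2 * ‖w‖ ^ 2 := by
  obtain ⟨e, he⟩ : ∃ e, e = z - zhat := ⟨_, rfl⟩
  obtain ⟨ζ, hζ⟩ : ∃ ζ, ζ = p.ψ (p.S.act z) - p.ψ (p.S.act zhat) := ⟨_, rfl⟩
  rw [← he] at hη ⊢
  -- In this lemma `η` stands for the output error θ̃ and `η'` for its derivative, not for
  -- measurement noise. Eliminating the observer state θ leaves only ε and θ̃.
  have hθ : θ = p.C.act e - η := by rw [hη]; abel
  have he₂ : e' = p.A.act e + p.B.act ζ + p.N.act w - (P₁⁻¹ * J).act θ := by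
    rw [he', he, hζ, drift, drift, Matrix.act_vec_sub, Matrix.act_vec_sub]; abel
  -- The term C L θ from C ε' cancels against the -C L in H, leaving only P₂⁻¹Yᵀ.
  have hη₂ : η' = p.C.act (p.A.act e) + p.C.act (p.B.act ζ) + p.C.act (p.N.act w)
      - (P₂⁻¹ * Y.transpose).act θ := by
    rw [hη', he₂, Matrix.act_sub, Matrix.act_mul p.C]
    simp only [Matrix.act_vec_add, Matrix.act_vec_sub]; abel
  have hJ : inner ℝ (P₁.act e) ((P₁⁻¹ * J).act θ)
      = inner ℝ e (J.act (p.C.act e)) - inner ℝ e (J.act η) := by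
    rw [← hP₁.inner_act_comm, hP₁.act_inv_act, hθ, Matrix.act_vec_sub, inner_sub_right]
  have hY : inner ℝ (P₂.act η) ((P₂⁻¹ * Y.transpose).act θ)
      = inner ℝ (Y.act η) (p.C.act e) - inner ℝ (Y.act η) η := by
    rw [← hP₂.inner_act_comm, hP₂.act_inv_act, Matrix.inner_transpose_act, hθ, inner_sub_right]
  have hζ' : ‖ζ‖ ^ 2 ≤ ℓ ^ 2 * ‖p.S.act e‖ ^ 2 := by
    have := hψ (p.S.act z) (p.S.act zhat)
    rw [← Matrix.act_vec_sub, ← he, ← hζ] at this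
    calc ‖ζ‖ ^ 2 ≤ (ℓ * ‖p.S.act e‖) ^ 2 := by gcongr
      _ = _ := by ring
  -- The S-procedure: χ times the Lipschitz constraint pays for the ζ terms of the quadratic form.
  have hχζ := mul_le_mul_of_nonneg_left hζ' hχ.le
  have q₀ := p.lmi_quadratic hP₁ hP₂ hLMI₀ e η w ζ
  have q₁ := p.lmi_quadratic hP₁ hP₂ hLMI₁ e η w ζ
  rw [he₂, hη₂]
  simp only [inner_add_right, inner_sub_right, hJ, hY]
  -- An affine function of s that is nonpositive at both ends of an interval is nonpositive on it.
  have affine : ∀ a b : ℝ, a + 1 * b ≤ 0 → a + s₁ * b ≤ 0 → a + s * b ≤ 0 := fun a b h h' => by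
    rcases le_total 0 b with hb | hb
    · nlinarith [mul_le_mul_of_nonneg_right hs.2 hb]
    · nlinarith [mul_le_mul_of_nonpos_right hs.1 hb]
  have q := affine _ _ q₀ q₁
  linarith

theorem hasDerivAt_lyap (hP₁ : P₁.PosDef) (hP₂ : P₂.PosDef) {x : ℝ → ObsState nz ny}
    {x' : ObsState nz ny} {t : ℝ} (hx : HasDerivAt x x' t) :
    HasDerivAt (fun s => p.lyap P₁ P₂ δ (x s))
      (2 * inner ℝ (P₁.act (ObsState.err (x t))) (ObsState.err x') +
        Real.exp (δ * ObsState.τL (x t)) *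
          (2 * inner ℝ (P₂.act (p.outErr (x t))) (p.outErr x') +
            δ * ObsState.τL x' * inner ℝ (p.outErr (x t)) (P₂.act (p.outErr (x t))))) t := by
  have h₁ : HasDerivAt (fun s => ObsState.err (x s)) (ObsState.err x') t :=
    (ObsState.err (nz := nz) (ny := ny)).hasFDerivAt.comp_hasDerivAt t hx
  have h₂ : HasDerivAt (fun s => p.outErr (x s)) (p.outErr x') t :=
    p.outErr.hasFDerivAt.comp_hasDerivAt t hx
  have h₃ : HasDerivAt (fun s => ObsState.τL (x s)) (ObsState.τL x') t :=
    (ObsState.τL (nz := nz) (ny := ny)).hasFDerivAt.comp_hasDerivAt t hx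
  exact hasDerivAt_weighted_inner (fun u v => hP₁.inner_act_comm u v)
    (fun u v => hP₂.inner_act_comm u v) δ h₁ h₂ h₃

/-- Along a flow, the Lyapunov function satisfies the dissipation inequality. -/
theorem exists_hasDerivAt_lyap
    (hψ : ∀ v₁ v₂ : Vec nq, ‖p.ψ v₁ - p.ψ v₂‖ ≤ ℓ * ‖v₁ - v₂‖)
    (hP₁ : P₁.PosDef) (hP₂ : P₂.PosDef) (hδ : 0 < δ) (hχ : 0 < χ) {T₁ T₂ : ℝ}
    (hLMI₀ : (-p.lmiMatrix ℓ lam γ δ χ 1 P₁ P₂ J Y).PosSemidef)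
    (hLMI₂ : (-p.lmiMatrix ℓ lam γ δ χ (Real.exp (δ * T₂)) P₁ P₂ J Y).PosSemidef)
    {x : ℝ → ObsState nz ny} {w : Vec nw} {t : ℝ} (hτ : (x t).τ ∈ Icc 0 T₂)
    (hx : HasDerivAt x ((p.withObserver T₁ T₂ (P₁⁻¹ * J)
      (P₂⁻¹ * Y.transpose - p.C * (P₁⁻¹ * J))).flowMap (x t) w) t) :
    ∃ d ≤ -(2 * lam) * p.lyap P₁ P₂ δ (x t) - ‖p.perfOutput (x t)‖ ^ 2 + γ ^ 2 * ‖w‖ ^ 2,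
      HasDerivAt (fun s => p.lyap P₁ P₂ δ (x s)) d t := by
  have hs : Real.exp (δ * (x t).τ) ∈ Icc 1 (Real.exp (δ * T₂)) :=
    ⟨Real.one_le_exp (mul_nonneg hδ.le hτ.1), Real.exp_le_exp.mpr (by gcongr; exact hτ.2)⟩
  have rate := p.lyap_rate hψ hP₁ hP₂ hχ hLMI₀ hLMI₂ hs (x t).z (x t).zhat _ (x t).θ _ _ w
    rfl rfl rfl
  have hd := p.hasDerivAt_lyap (δ := δ) hP₁ hP₂ hx
  refine ⟨_, le_of_eq_of_le ?_ rate, hd⟩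
  -- The timer rate -1 turns δ τ' into the -δ of the lower-right block.
  have h₁ : ObsState.τL ((p.withObserver T₁ T₂ (P₁⁻¹ * J)
      (P₂⁻¹ * Y.transpose - p.C * (P₁⁻¹ * J))).flowMap (x t) w) = -1 := rfl
  rw [h₁, mul_neg_one, neg_mul, ← sub_eq_add_neg]
  rfl

end PlantData

/-- For each a in s, f x = f (x - a), so |f x| ≤ ‖f‖ |x - a|; passing to the infimum avoids choosing
a nearest point. -/
theorem ContinuousLinearMap.exists_norm_le_mul_infDist {E F : Type*} [NormedAddCommGroup E]
    [NormedSpace ℝ E] [NormedAddCommGroup F] [NormedSpace ℝ F] (f : E →L[ℝ] F) {s : Set E}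
    (hs : s.Nonempty) (h : ∀ a ∈ s, f a = 0) : ∃ K > 0, ∀ x, ‖f x‖ ≤ K * Metric.infDist x s := by
  refine ⟨‖f‖ + 1, by positivity, fun x => ?_⟩
  rw [← div_le_iff₀' (by positivity), Metric.le_infDist hs]
  intro a ha
  rw [div_le_iff₀' (by positivity), dist_eq_norm]
  calc ‖f x‖ = ‖f (x - a)‖ := by rw [map_sub, h a ha, sub_zero]
    _ ≤ ‖f‖ * ‖x - a‖ := f.le_opNorm _
    _ ≤ _ := by gcongr; simp

namespace PlantData

variable {nz ny nw nq ns np : ℕ} (p : PlantData nz ny nw nq ns np)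
  {ℓ lam γ δ χ T₁ T₂ : ℝ} {P₁ : Matrix (Fin nz) (Fin nz) ℝ} {P₂ : Matrix (Fin ny) (Fin ny) ℝ}
  {J : Matrix (Fin nz) (Fin ny) ℝ} {Y : Matrix (Fin ny) (Fin ny) ℝ}
  {L : Matrix (Fin nz) (Fin ny) ℝ} {H : Matrix (Fin ny) (Fin ny) ℝ}
  {φ : HybridSignal (ObsState nz ny)} {u : HybridSignal (InputPair (Vec nw) (Vec ny))}

/-! ### The Lyapunov function and the distance to the target -/

theorem target_nonempty (hT₂ : 0 ≤ T₂) : (p.target T₂).Nonempty :=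
  ⟨ObsState.mk 0 0 0 0, sub_self _, by simp [ObsState.mk, ObsState.z, ObsState.zhat, ObsState.θ],
    le_rfl, hT₂⟩

theorem lyap_nonneg (hP₁ : P₁.PosDef) (hP₂ : P₂.PosDef) (x : ObsState nz ny) :
    inner ℝ (ObsState.err x) (P₁.act (ObsState.err x)) ≤ p.lyap P₁ P₂ δ x ∧
    Real.exp (δ * x.τ) * inner ℝ (p.outErr x) (P₂.act (p.outErr x)) ≤ p.lyap P₁ P₂ δ x ∧
    0 ≤ p.lyap P₁ P₂ δ x := by
  obtain ⟨K₁, hK₁, h₁⟩ := hP₁.exists_norm_sq_le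
  obtain ⟨K₂, hK₂, h₂⟩ := hP₂.exists_norm_sq_le
  have i₁ : 0 ≤ inner ℝ (ObsState.err x) (P₁.act (ObsState.err x)) :=
    nonneg_of_mul_nonneg_right ((sq_nonneg _).trans (h₁ _)) hK₁
  have i₂ : 0 ≤ inner ℝ (p.outErr x) (P₂.act (p.outErr x)) :=
    nonneg_of_mul_nonneg_right ((sq_nonneg _).trans (h₂ _)) hK₂
  have i₃ := mul_nonneg (Real.exp_pos (δ * x.τ)).le i₂
  have : p.lyap P₁ P₂ δ x = inner ℝ (ObsState.err x) (P₁.act (ObsState.err x)) +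
    Real.exp (δ * x.τ) * inner ℝ (p.outErr x) (P₂.act (p.outErr x)) := rfl
  rw [this]
  exact ⟨by linarith, by linarith, by linarith⟩

/-- The distance is tested at the single point (z, z, 0, τ) of the target, which leaves |ε|² + |θ|²
with θ = Cε - θ̃. The weight e^(δτ) can be discarded because τ ≥ 0. -/
theorem exists_infDist_sq_le (hP₁ : P₁.PosDef) (hP₂ : P₂.PosDef) (hδ : 0 < δ) :
    ∃ c > 0, ∀ x : ObsState nz ny, x.τ ∈ Icc 0 T₂ →
      Metric.infDist x (p.target T₂) ^ 2 ≤ c * p.lyap P₁ P₂ δ x := by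
  obtain ⟨K₁, hK₁, h₁⟩ := hP₁.exists_norm_sq_le
  obtain ⟨K₂, hK₂, h₂⟩ := hP₂.exists_norm_sq_le
  refine ⟨(1 + 2 * ‖p.C.actL‖ ^ 2) * K₁ + 2 * K₂, by positivity, fun x hx => ?_⟩
  obtain ⟨l₁, l₂, l₃⟩ := p.lyap_nonneg (δ := δ) hP₁ hP₂ x
  have hmem : ObsState.mk x.z x.z 0 x.τ ∈ p.target T₂ :=
    ⟨sub_self _, by simp [ObsState.mk, ObsState.z, ObsState.zhat, ObsState.θ], hx⟩
  have hdist : Metric.infDist x (p.target T₂) ^ 2 ≤ ‖ObsState.err x‖ ^ 2 + ‖x.θ‖ ^ 2 := by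
    have hd := Metric.infDist_le_dist_of_mem (x := x) hmem
    have hn : dist x (ObsState.mk x.z x.z 0 x.τ) ^ 2 = ‖ObsState.err x‖ ^ 2 + ‖x.θ‖ ^ 2 := by
      have hs : x - ObsState.mk x.z x.z 0 x.τ
          = ObsState.mk (x.z - x.z) (x.zhat - x.z) (x.θ - 0) (x.τ - x.τ) := rfl
      rw [dist_eq_norm, hs, ObsState.norm_mk_sq, ObsState.err_apply, norm_sub_rev x.zhat]
      simp
    rw [← hn]
    exact pow_le_pow_left₀ Metric.infDist_nonneg hd 2
  have hθ : ‖x.θ‖ ^ 2 ≤ 2 * ‖p.C.actL‖ ^ 2 * ‖ObsState.err x‖ ^ 2 + 2 * ‖p.outErr x‖ ^ 2 := by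
    have e : x.θ = p.C.act (ObsState.err x) - p.outErr x := by
      rw [outErr_apply, ObsState.err_apply]; abel
    have h₃ : ‖x.θ‖ ≤ ‖p.C.actL‖ * ‖ObsState.err x‖ + ‖p.outErr x‖ := by
      rw [e]
      exact (norm_sub_le _ _).trans (by gcongr; exact Matrix.norm_act_le _ _)
    calc ‖x.θ‖ ^ 2 ≤ (‖p.C.actL‖ * ‖ObsState.err x‖ + ‖p.outErr x‖) ^ 2 := by gcongr
      _ ≤ _ := by nlinarith [sq_nonneg (‖p.C.actL‖ * ‖ObsState.err x‖ - ‖p.outErr x‖)]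
  have h₁' := (h₁ (ObsState.err x)).trans (mul_le_mul_of_nonneg_left l₁ hK₁.le)
  have h₂' : ‖p.outErr x‖ ^ 2 ≤ K₂ * p.lyap P₁ P₂ δ x := by
    refine (h₂ _).trans (mul_le_mul_of_nonneg_left (le_trans ?_ l₂) hK₂.le)
    refine le_mul_of_one_le_left ?_ (Real.one_le_exp (mul_nonneg hδ.le hx.1))
    exact nonneg_of_mul_nonneg_right ((sq_nonneg _).trans (h₂ _)) hK₂
  calc Metric.infDist x (p.target T₂) ^ 2 ≤ ‖ObsState.err x‖ ^ 2 + ‖x.θ‖ ^ 2 := hdist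
    _ ≤ (1 + 2 * ‖p.C.actL‖ ^ 2) * ‖ObsState.err x‖ ^ 2 + 2 * ‖p.outErr x‖ ^ 2 := by linarith
    _ ≤ (1 + 2 * ‖p.C.actL‖ ^ 2) * (K₁ * p.lyap P₁ P₂ δ x) + 2 * (K₂ * p.lyap P₁ P₂ δ x) := by
        gcongr
    _ = _ := by ring

/-- Both ε and θ̃ are linear and vanish on the target, so each is bounded by the distance; the
weight is at most e^(δT₂). -/
theorem exists_lyap_le (hδ : 0 < δ) (hT₂ : 0 ≤ T₂) (P₁ : Matrix (Fin nz) (Fin nz) ℝ)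
    (P₂ : Matrix (Fin ny) (Fin ny) ℝ) :
    ∃ c > 0, ∀ x : ObsState nz ny, x.τ ∈ Icc 0 T₂ →
      p.lyap P₁ P₂ δ x ≤ c * Metric.infDist x (p.target T₂) ^ 2 := by
  obtain ⟨K₁, hK₁, h₁⟩ := (ObsState.err (nz := nz) (ny := ny)).exists_norm_le_mul_infDist
    (p.target_nonempty hT₂) (fun a ha => ha.1)
  obtain ⟨K₂, hK₂, h₂⟩ := p.outErr.exists_norm_le_mul_infDist
    (p.target_nonempty hT₂) (fun a ha => ha.2.1)
  -- The added 1 keeps the constant strictly positive even if the operator norms vanish.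
  refine ⟨(‖P₁.actL‖ + 1) * K₁ ^ 2 + Real.exp (δ * T₂) * (‖P₂.actL‖ * K₂ ^ 2), by positivity,
    fun x hx => ?_⟩
  set d := Metric.infDist x (p.target T₂)
  have e₁ : inner ℝ (ObsState.err x) (P₁.act (ObsState.err x)) ≤ (‖P₁.actL‖ + 1) * (K₁ * d) ^ 2 :=
    (Matrix.inner_act_le _ _).trans (mul_le_mul (by simp) (by gcongr; exact h₁ x) (by positivity)
      (by positivity))
  have e₂ : inner ℝ (p.outErr x) (P₂.act (p.outErr x)) ≤ ‖P₂.actL‖ * (K₂ * d) ^ 2 :=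
    (Matrix.inner_act_le _ _).trans (by gcongr; exact h₂ x)
  calc p.lyap P₁ P₂ δ x = inner ℝ (ObsState.err x) (P₁.act (ObsState.err x)) +
        Real.exp (δ * x.τ) * inner ℝ (p.outErr x) (P₂.act (p.outErr x)) := rfl
    _ ≤ (‖P₁.actL‖ + 1) * (K₁ * d) ^ 2 +
        Real.exp (δ * x.τ) * (‖P₂.actL‖ * (K₂ * d) ^ 2) := by gcongr
    _ ≤ (‖P₁.actL‖ + 1) * (K₁ * d) ^ 2 +
        Real.exp (δ * T₂) * (‖P₂.actL‖ * (K₂ * d) ^ 2) := by gcongr; exact hx.2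
    _ = _ := by ring

/-! ### The timer -/

theorem isClosed_flowSet : IsClosed (p.withObserver T₁ T₂ L H).flowSet :=
  isClosed_Icc.preimage (ObsState.τL (nz := nz) (ny := ny)).continuous

variable {p} in
theorem timer_mem (hT₁ : 0 < T₁) (hT₁₂ : T₁ ≤ T₂)
    (h : (p.withObserver T₁ T₂ L H).IsSolutionPair φ u) {t : ℝ} {j : ℕ} (ht : (t, j) ∈ φ.dom) :
    (φ.val t j).τ ∈ Icc 0 T₂ := by
  refine φ.isDomain.induction (P := fun t j => (φ.val t j).τ ∈ Icc 0 T₂) ?_ ?_ ?_ ht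
  · rcases h.init with h0 | h0
    · rw [p.isClosed_flowSet.closure_eq] at h0
      exact h0
    · have h0 : (φ.val 0 0).τ = 0 := h0
      rw [h0]
      exact ⟨le_rfl, by linarith⟩
  · intro j a b hab ha hb hP
    rcases hab.eq_or_lt with rfl | hlt
    · exact hP
    have hsub := φ.Icc_subset_slice ha hb
    have hcont := (h.arc j a b hab hsub).continuousOn
    rw [uIcc_of_le hab] at hcont
    -- Membership in the flow set is required only in the interior of a slice; closedness of the
    -- flow set and continuity of the arc carry it to the endpoint.
    have hb' : b ∈ closure (Ioo a b) := by
      rw [closure_Ioo hlt.ne]; exact right_mem_Icc.mpr hab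
    have hmaps : MapsTo (fun t => φ.val t j) (Ioo a b) (p.withObserver T₁ T₂ L H).flowSet :=
      fun t ht => h.flow_mem j t (interior_mono hsub (by rwa [interior_Icc]))
    have := ((hcont b (right_mem_Icc.mpr hab)).mono Ioo_subset_Icc_self).mem_closure hb' hmaps
    rw [p.isClosed_flowSet.closure_eq] at this
    exact this
  · intro t j ht ht' _
    obtain ⟨-, v, hv, heq⟩ := h.jump t j ht ht'
    rw [heq]
    exact ⟨hT₁.le.trans hv.1, hv.2⟩

variable {p} in
theorem arc_contDiff_comp (h : (p.withObserver T₁ T₂ L H).IsSolutionPair φ u)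
    {g : ObsState nz ny → ℝ} (hg : ContDiff ℝ 1 g) (j : ℕ) (a b : ℝ) (hab : a ≤ b)
    (hsub : Icc a b ⊆ φ.slice j) :
    AbsolutelyContinuousOnInterval (fun t => g (φ.val t j)) a b :=
  (h.arc j a b hab hsub).contDiff_comp hg

variable {p} in
theorem hasDerivAt_timer {x : ℝ → ObsState nz ny} {w : Vec nw} {t : ℝ}
    (hx : HasDerivAt x ((p.withObserver T₁ T₂ L H).flowMap (x t) w) t) :
    HasDerivAt (fun s => ObsState.τL (x s)) (-1) t :=
  (ObsState.τL (nz := nz) (ny := ny)).hasFDerivAt.comp_hasDerivAt t hx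

variable {p} in
-- The quantity j T₁ - t - τ is constant during flows, since t + τ is, and cannot increase at a
-- jump, where j grows by 1 and τ goes from 0 to at least T₁. It starts nonpositive, and τ ≤ T₂. The
-- decay lemma is used with rate 0.
theorem jumps_mul_le (hT₁ : 0 < T₁) (hT₁₂ : T₁ ≤ T₂)
    (h : (p.withObserver T₁ T₂ L H).IsSolutionPair φ u) {t : ℝ} {j : ℕ} (ht : (t, j) ∈ φ.dom) :
    j * T₁ ≤ t + T₂ := by
  have key := φ.exp_decay (g := fun t j => j * T₁ - t - ObsState.τL (φ.val t j)) 0 ?_ ?_ ?_ ht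
  · have h₀ := timer_mem hT₁ hT₁₂ h φ.isDomain.zero_mem
    have h₁ := timer_mem hT₁ hT₁₂ h ht
    have e₀ : 0 ≤ ObsState.τL (φ.val 0 0) := h₀.1
    have e₁ : ObsState.τL (φ.val t j) ≤ T₂ := h₁.2
    simp only [neg_zero, zero_mul, Real.exp_zero, one_mul, Nat.cast_zero, zero_sub] at key
    linarith
  · intro j a b hab hsub
    have h₁ : AbsolutelyContinuousOnInterval (fun t : ℝ => j * T₁ - t) a b :=
      ContDiff.contDiffOn (by fun_prop) |>.absolutelyContinuousOnInterval
    exact h₁.sub (arc_contDiff_comp h (ContinuousLinearMap.contDiff _) j a b hab hsub)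
  · intro j
    filter_upwards [h.flow j] with t ht
    refine ⟨0, by simp, ?_⟩
    exact (((hasDerivAt_id t).const_sub (j * T₁)).sub (hasDerivAt_timer ht)).congr_deriv (by simp)
  · intro t j ht ht'
    obtain ⟨h0, v, hv, heq⟩ := h.jump t j ht ht'
    have h0 : ObsState.τL (φ.val t j) = 0 := h0
    have h1 : ObsState.τL (φ.val t (j + 1)) = v := by rw [heq]; rfl
    simp only [h0, h1]
    push_cast
    linarith [hv.1]

/-! ### The Lyapunov function along solutions -/

/-- After a sample θ̃⁺ = Cε - (Cz + η - Cẑ) = -η, whatever θ̃ was before, while ε is untouched. The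
old θ̃ term is nonnegative and is dropped. -/
theorem lyap_jump_le (hP₁ : P₁.PosDef) (hP₂ : P₂.PosDef) (hδ : 0 < δ) {x x' : ObsState nz ny}
    {η : Vec ny} (hx : x' ∈ (p.withObserver T₁ T₂ L H).jumpMap x η) :
    p.lyap P₁ P₂ δ x' ≤ p.lyap P₁ P₂ δ x + Real.exp (δ * T₂) * ‖P₂.actL‖ * ‖η‖ ^ 2 := by
  obtain ⟨v, hv, rfl⟩ := hx
  obtain ⟨l₁, -, -⟩ := p.lyap_nonneg (δ := δ) hP₁ hP₂ x
  have e₁ : p.outErr (ObsState.mk x.z x.zhat ((p.C.act x.z + η) - p.C.act x.zhat) v) = -η := by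
    have : p.outErr (ObsState.mk x.z x.zhat ((p.C.act x.z + η) - p.C.act x.zhat) v)
      = p.C.act (x.z - x.zhat) - ((p.C.act x.z + η) - p.C.act x.zhat) := rfl
    rw [this, Matrix.act_vec_sub]; abel
  have e₂ : p.lyap P₁ P₂ δ (ObsState.mk x.z x.zhat ((p.C.act x.z + η) - p.C.act x.zhat) v)
      = inner ℝ (ObsState.err x) (P₁.act (ObsState.err x)) +
        Real.exp (δ * v) * inner ℝ (-η) (P₂.act (-η)) := by
    rw [← e₁]; rfl
  have e₃ := Matrix.inner_act_le P₂ (-η)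
  rw [norm_neg] at e₃
  rw [e₂]
  have : Real.exp (δ * v) * inner ℝ (-η) (P₂.act (-η))
      ≤ Real.exp (δ * T₂) * (‖P₂.actL‖ * ‖η‖ ^ 2) := by
    calc _ ≤ Real.exp (δ * v) * (‖P₂.actL‖ * ‖η‖ ^ 2) := by gcongr
      _ ≤ _ := by gcongr; exact hv.2
  linarith

/-- The Lyapunov function decays exponentially up to a multiple of the squared size of the
input. -/
theorem exists_lyap_solution_le (hψ : ∀ v₁ v₂ : Vec nq, ‖p.ψ v₁ - p.ψ v₂‖ ≤ ℓ * ‖v₁ - v₂‖)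
    (hT₁ : 0 < T₁) (hT₁₂ : T₁ ≤ T₂) (hlam : 0 < lam)
    (hP₁ : P₁.PosDef) (hP₂ : P₂.PosDef) (hδ : 0 < δ) (hχ : 0 < χ)
    (hLMI₀ : (-p.lmiMatrix ℓ lam γ δ χ 1 P₁ P₂ J Y).PosSemidef)
    (hLMI₂ : (-p.lmiMatrix ℓ lam γ δ χ (Real.exp (δ * T₂)) P₁ P₂ J Y).PosSemidef) :
    ∃ K ≥ 0, ∀ φ u, (p.withObserver T₁ T₂ (P₁⁻¹ * J)
          (P₂⁻¹ * Y.transpose - p.C * (P₁⁻¹ * J))).IsSolutionPair φ u → ∀ r : ℝ,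
      (∀ j, ∀ᵐ t ∂(volume.restrict (φ.slice j)), ‖(u.val t j).fst‖ ≤ r) →
      (∀ t j, (t, j) ∈ φ.dom → (t, j + 1) ∈ φ.dom → ‖(u.val t j).snd‖ ≤ r) →
      ∀ t j, (t, j) ∈ φ.dom → p.lyap P₁ P₂ δ (φ.val t j) ≤
        Real.exp (-(2 * lam) * t) * p.lyap P₁ P₂ δ (φ.val 0 0) + K * r ^ 2 := by
  set a := 2 * lam with ha_def
  have ha : 0 < a := by positivity
  set c := Real.exp (δ * T₂) * ‖P₂.actL‖ with hc_def
  have hc : 0 ≤ c := by positivity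
  have hexp : Real.exp (-(a * T₁)) < 1 := Real.exp_lt_one_iff.mpr (by simpa using mul_pos ha hT₁)
  -- The sum of the geometric series with ratio e^(-aT₁), the least decay between consecutive
  -- samples; it accumulates the noise contributions.
  set q := (1 - Real.exp (-(a * T₁)))⁻¹ with hq_def
  have hq0 : 0 < 1 - Real.exp (-(a * T₁)) := by linarith
  have hq : 0 < q := inv_pos.mpr hq0
  have hq1 : q * (1 - Real.exp (-(a * T₁))) = 1 := inv_mul_cancel₀ hq0.ne'
  refine ⟨c * q * Real.exp (a * (T₂ - T₁)) + γ ^ 2 / a, by positivity, ?_⟩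
  intro φ u h r hw hη t j ht
  -- The correction e^(a(τ - T₁)) decays at exactly the rate a along flows, so it preserves the
  -- differential inequality; the constant γ²r²/a absorbs the disturbance w. At a jump the
  -- correction rises from c q r² e^(-aT₁) to at least c q r². By the choice of q the rise is at
  -- least c r², which offsets the growth of V caused by the noise.
  have key := φ.exp_decay (g := fun t j => p.lyap P₁ P₂ δ (φ.val t j)
    - c * q * r ^ 2 * Real.exp (a * (ObsState.τL (φ.val t j) - T₁)) - γ ^ 2 * r ^ 2 / a) a ?_ ?_ ?_ ht
  · have h₁ : ObsState.τL (φ.val t j) ≤ T₂ := (timer_mem hT₁ hT₁₂ h ht).2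
    have h₂ : Real.exp (a * (ObsState.τL (φ.val t j) - T₁)) ≤ Real.exp (a * (T₂ - T₁)) := by
      gcongr
    have h₃ := mul_le_mul_of_nonneg_left h₂ (show 0 ≤ c * q * r ^ 2 by positivity)
    have h₄ : Real.exp (-a * t) * (p.lyap P₁ P₂ δ (φ.val 0 0)
        - c * q * r ^ 2 * Real.exp (a * (ObsState.τL (φ.val 0 0) - T₁)) - γ ^ 2 * r ^ 2 / a)
        ≤ Real.exp (-a * t) * p.lyap P₁ P₂ δ (φ.val 0 0) := by
      gcongr
      have : 0 ≤ c * q * r ^ 2 * Real.exp (a * (ObsState.τL (φ.val 0 0) - T₁)) := by positivity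
      have : 0 ≤ γ ^ 2 * r ^ 2 / a := by positivity
      linarith
    have h₅ : γ ^ 2 * r ^ 2 / a = γ ^ 2 / a * r ^ 2 := by ring
    linarith
  · intro j s t hst hsub
    refine arc_contDiff_comp h (g := fun x => p.lyap P₁ P₂ δ x
      - c * q * r ^ 2 * Real.exp (a * (ObsState.τL x - T₁)) - γ ^ 2 * r ^ 2 / a) ?_ j s t hst hsub
    have h₃ : ContDiff ℝ 1 (ObsState.τL (nz := nz) (ny := ny)) := ContinuousLinearMap.contDiff _
    exact ((p.contDiff_lyap P₁ P₂ δ).sub (contDiff_const.mul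
      (contDiff_const.mul (h₃.sub contDiff_const)).exp)).sub contDiff_const
  · intro j
    filter_upwards [h.flow j, hw j, ae_restrict_mem (φ.measurableSet_slice j)] with t hx hwt htj
    obtain ⟨d, hd', hd⟩ := p.exists_hasDerivAt_lyap hψ hP₁ hP₂ hδ hχ hLMI₀ hLMI₂
      (timer_mem hT₁ hT₁₂ h htj) hx
    have hτ := (((hasDerivAt_timer hx).sub_const T₁).const_mul a).exp.const_mul (c * q * r ^ 2)
    refine ⟨_, ?_, (hd.sub hτ).sub_const _⟩
    have hw2 : γ ^ 2 * ‖(u.val t j).fst‖ ^ 2 ≤ γ ^ 2 * r ^ 2 := by gcongr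
    have h₁ : a * (γ ^ 2 * r ^ 2 / a) = γ ^ 2 * r ^ 2 := by field_simp
    have h₂ := sq_nonneg ‖p.perfOutput (φ.val t j)‖
    linarith
  · intro t j ht ht'
    obtain ⟨h0, hj⟩ := h.jump t j ht ht'
    have hl := p.lyap_jump_le hP₁ hP₂ hδ hj
    obtain ⟨v, hv, heq⟩ := hj
    have h0 : ObsState.τL (φ.val t j) = 0 := h0
    have h1 : ObsState.τL (φ.val t (j + 1)) = v := by rw [heq]; rfl
    have hr := hη t j ht ht'
    have hr2 : ‖(u.val t j).snd‖ ^ 2 ≤ r ^ 2 := by gcongr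
    have hcr := mul_le_mul_of_nonneg_left hr2 hc
    have h2 : 1 ≤ Real.exp (a * (v - T₁)) :=
      Real.one_le_exp (mul_nonneg ha.le (by linarith [hv.1]))
    have h3 := mul_le_mul_of_nonneg_left h2 (show 0 ≤ c * q * r ^ 2 by positivity)
    have h4 : c * q * r ^ 2 * Real.exp (-(a * T₁)) = c * q * r ^ 2 - c * r ^ 2 := by
      linear_combination c * r ^ 2 * (-hq1)
    have h5 : a * (0 - T₁) = -(a * T₁) := by ring
    simp only [h0, h1, h5, h4]
    linarith

end PlantData

/-! ### Norms of hybrid signals -/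

namespace HybridSignal

variable {E : Type*} [NormedAddCommGroup E] (u : HybridSignal E)

theorem enorm_le_truncSupNorm {t : ℝ} {j : ℕ} {T : ℝ} (ht : (t, j) ∈ u.dom)
    (ht' : (t, j + 1) ∈ u.dom) (hT : t + j ≤ T) : ‖u.val t j‖ₑ ≤ u.truncSupNorm T :=
  le_trans (le_iSup₂ (f := fun (p : ℝ × ℕ) (_ : p ∈ {p : ℝ × ℕ | p ∈ u.dom ∧
    (p.1, p.2 + 1) ∈ u.dom ∧ p.1 + p.2 ≤ T}) => ‖u.val p.1 p.2‖ₑ) (t, j) ⟨ht, ht', hT⟩)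
    (le_max_right _ _)

/-- The essential supremum in the norm leaves out jump points, but there the pointwise supremum
applies. -/
theorem ae_enorm_le_truncSupNorm (j : ℕ) (T : ℝ) :
    ∀ᵐ t ∂(volume.restrict (u.slice j)), t + j ≤ T → ‖u.val t j‖ₑ ≤ u.truncSupNorm T := by
  have hS : MeasurableSet {s : ℝ | (s, j) ∈ u.dom ∧ (s, j + 1) ∉ u.dom ∧ s + j ≤ T} := by
    have h₃ : MeasurableSet {s : ℝ | s + j ≤ T} :=
      measurableSet_le (by fun_prop) measurable_const
    exact (u.measurableSet_slice j).inter ((u.measurableSet_slice (j + 1)).compl.inter h₃)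
  have h := ENNReal.ae_le_essSup (μ := volume.restrict
    {s : ℝ | (s, j) ∈ u.dom ∧ (s, j + 1) ∉ u.dom ∧ s + j ≤ T}) (fun s => ‖u.val s j‖ₑ)
  rw [ae_restrict_iff' hS] at h
  rw [ae_restrict_iff' (u.measurableSet_slice j)]
  filter_upwards [h] with t ht htj hT
  by_cases htj' : (t, j + 1) ∈ u.dom
  · exact u.enorm_le_truncSupNorm htj htj' hT
  · exact (ht ⟨htj, htj', hT⟩).trans ((le_iSup (fun k : ℕ => essSup (fun s => ‖u.val s k‖ₑ)
      (volume.restrict {s : ℝ | (s, k) ∈ u.dom ∧ (s, k + 1) ∉ u.dom ∧ s + k ≤ T})) j).trans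
      (le_max_left _ _))

theorem norm_le_supNorm (hu : u.supNorm < ∞) {t : ℝ} {j : ℕ} (ht : (t, j) ∈ u.dom)
    (ht' : (t, j + 1) ∈ u.dom) : ‖u.val t j‖ ≤ u.supNorm.toReal := by
  rw [← toReal_enorm]
  exact ENNReal.toReal_mono hu.ne ((u.enorm_le_truncSupNorm ht ht' le_rfl).trans (le_iSup _ _))

theorem ae_norm_le_supNorm (hu : u.supNorm < ∞) (j : ℕ) :
    ∀ᵐ t ∂(volume.restrict (u.slice j)), ‖u.val t j‖ ≤ u.supNorm.toReal := by
  -- Integer truncation levels suffice and keep the intersection of full-measure sets countable.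
  have h : ∀ᵐ t ∂(volume.restrict (u.slice j)), ∀ n : ℕ,
      t + j ≤ (n : ℝ) → ‖u.val t j‖ₑ ≤ u.truncSupNorm (n : ℝ) :=
    ae_all_iff.mpr fun n => u.ae_enorm_le_truncSupNorm j n
  filter_upwards [h] with t ht
  obtain ⟨n, hn⟩ := exists_nat_ge (t + j)
  rw [← toReal_enorm]
  exact ENNReal.toReal_mono hu.ne ((ht n hn).trans (le_iSup u.truncSupNorm (n : ℝ)))

end HybridSignal

/-! ### Order structure of hybrid time domains -/

namespace IsHybridTimeDomain

variable {D : Set (ℝ × ℕ)}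

theorem le_of_lt (hD : IsHybridTimeDomain D) {s t : ℝ} {i j : ℕ} (hs : (s, i) ∈ D)
    (ht : (t, j) ∈ D) (hij : i < j) : s ≤ t := by
  induction j generalizing t with
  | zero => omega
  | succ j ih =>
    obtain ⟨r, hrt, hr, -, hmax, -⟩ := hD.exists_jump_time ht
    rcases Nat.lt_succ_iff_lt_or_eq.mp hij with h | rfl
    · exact (ih hr h).trans hrt
    · exact (hmax s hs).trans hrt

theorem exists_mem_of_le (hD : IsHybridTimeDomain D) {s t : ℝ} {j : ℕ} (ht : (t, j) ∈ D)
    (hs : 0 ≤ s) (hst : s ≤ t) : ∃ i, (s, i) ∈ D := by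
  refine hD.induction (P := fun t _ => ∀ s, 0 ≤ s → s ≤ t → ∃ i, (s, i) ∈ D) ?_ ?_ ?_ ht s hs hst
  · intro s h h'
    exact ⟨0, by rw [le_antisymm h' h]; exact hD.zero_mem⟩
  · intro j a b _ ha hb h s hs hsb
    rcases le_total s a with hsa | has
    · exact h s hs hsa
    · exact ⟨j, (hD.ordConnected j).out ha hb ⟨has, hsb⟩⟩
  · intro t j _ _ h
    exact h

end IsHybridTimeDomain

/-- A smaller index at time s would force s ≤ a, because earlier slices lie to the left of later
ones. Hence on a slice, away from its left end, the signal read at `jmin` is the signal of that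
slice. -/
theorem HybridSignal.jmin_eq {E : Type*} (φ : HybridSignal E) {a s : ℝ} {j : ℕ}
    (ha : (a, j) ∈ φ.dom) (hs : (s, j) ∈ φ.dom) (has : a < s) : φ.jmin s = j := by
  refine le_antisymm (Nat.sInf_le hs) ?_
  by_contra! h
  exact has.not_ge (φ.isDomain.le_of_lt (Nat.sInf_mem (s := {j | (s, j) ∈ φ.dom}) ⟨j, hs⟩) ha h)

/-! ### Dissipation inequalities in integral form -/

/-- Splitting v' into positive and negative parts keeps everything in `ℝ≥0∞`, so f and g may be
nonmeasurable or have infinite integrals; only v' is integrable. -/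
theorem AbsolutelyContinuousOnInterval.ofReal_add_lintegral_le {v : ℝ → ℝ} {a b : ℝ}
    (hv : AbsolutelyContinuousOnInterval v a b) (hab : a ≤ b) (hpos : ∀ t, 0 ≤ v t)
    {f g : ℝ → ℝ≥0∞} (h : ∀ᵐ t ∂(volume.restrict (Ioc a b)), ∃ d, HasDerivAt v d t ∧
      f t + ENNReal.ofReal d ≤ g t + ENNReal.ofReal (-d)) :
    ENNReal.ofReal (v b) + ∫⁻ t in Ioc a b, f t ≤
      ENNReal.ofReal (v a) + ∫⁻ t in Ioc a b, g t := by
  have hint : Integrable (deriv v) (volume.restrict (Ioc a b)) := by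
    have := hv.intervalIntegrable_deriv
    rwa [intervalIntegrable_iff_integrableOn_Ioc_of_le hab] at this
  have hftc := hv.integral_deriv_eq_sub
  rw [intervalIntegral.integral_of_le hab, integral_eq_lintegral_pos_part_sub_lintegral_neg_part
    hint] at hftc
  set p := ∫⁻ t in Ioc a b, ENNReal.ofReal (deriv v t) with hp
  set n := ∫⁻ t in Ioc a b, ENNReal.ofReal (-deriv v t) with hn
  have hp' : p ≠ ∞ := hint.lintegral_lt_top.ne
  have hn' : n ≠ ∞ := hint.neg.lintegral_lt_top.ne
  have hm : AEMeasurable (fun t => ENNReal.ofReal (deriv v t)) (volume.restrict (Ioc a b)) :=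
    hint.aemeasurable.ennreal_ofReal
  have hm' : AEMeasurable (fun t => ENNReal.ofReal (-deriv v t)) (volume.restrict (Ioc a b)) :=
    hint.aemeasurable.neg.ennreal_ofReal
  have key : (∫⁻ t in Ioc a b, f t) + p ≤ (∫⁻ t in Ioc a b, g t) + n := by
    rw [hp, hn, ← lintegral_add_right' _ hm, ← lintegral_add_right' _ hm']
    refine lintegral_mono_ae ?_
    filter_upwards [h] with t ⟨d, hd, hle⟩
    rwa [hd.deriv]
  -- The fundamental theorem of calculus, rearranged without subtraction.
  have bal : ENNReal.ofReal (v b) + n = ENNReal.ofReal (v a) + p := by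
    rw [← ENNReal.ofReal_toReal hp', ← ENNReal.ofReal_toReal hn',
      ← ENNReal.ofReal_add (hpos _) ENNReal.toReal_nonneg,
      ← ENNReal.ofReal_add (hpos _) ENNReal.toReal_nonneg]
    congr 1
    linarith
  -- Cancelling p + n is legitimate because both are finite.
  refine (ENNReal.add_le_add_iff_right (ENNReal.add_ne_top.mpr ⟨hp', hn'⟩)).mp ?_
  calc ENNReal.ofReal (v b) + (∫⁻ t in Ioc a b, f t) + (p + n)
      = (ENNReal.ofReal (v b) + n) + ((∫⁻ t in Ioc a b, f t) + p) := by ring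
    _ ≤ (ENNReal.ofReal (v a) + p) + ((∫⁻ t in Ioc a b, g t) + n) := by
        rw [bal]; gcongr
    _ = _ := by ring

theorem ENNReal.ofReal_add_le_of_add_le {y d w : ℝ} (hw : 0 ≤ w) (hy : 0 ≤ y) (h : y + d ≤ w) :
    ENNReal.ofReal y + ENNReal.ofReal d ≤ ENNReal.ofReal w + ENNReal.ofReal (-d) := by
  rcases le_total 0 d with hd | hd
  · rw [← ENNReal.ofReal_add hy hd]
    exact (ENNReal.ofReal_le_ofReal h).trans le_self_add
  · rw [ENNReal.ofReal_of_nonpos hd, add_zero, ← ENNReal.ofReal_add hw (by linarith)]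
    exact ENNReal.ofReal_le_ofReal (by linarith)

/-- The intervals (0, q] with q rational and below some point of S form a countable directed family,
so the bound passes to their union. The union covers S up to the point 0 and a possible greatest
element of S. -/
theorem setLIntegral_le_of_forall_Ioc {S : Set ℝ} (hS : S ⊆ Ici 0) {f : ℝ → ℝ≥0∞} {M : ℝ≥0∞}
    (h : ∀ t ∈ S, ∫⁻ s in Ioc 0 t, f s ≤ M) : ∫⁻ s in S, f s ≤ M := by
  let U : {q : ℚ // ∃ t ∈ S, (q : ℝ) ≤ t} → Set ℝ := fun q => Ioc 0 (q : ℝ)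
  have hdir : Directed (· ⊆ ·) U := fun q r => by
    rcases le_total q.1 r.1 with hqr | hqr
    · exact ⟨r, Ioc_subset_Ioc_right (by exact_mod_cast hqr), subset_rfl⟩
    · exact ⟨q, subset_rfl, Ioc_subset_Ioc_right (by exact_mod_cast hqr)⟩
  have hU : ∫⁻ s in ⋃ q, U q, f s ≤ M := by
    rw [setLIntegral_iUnion_of_directed f hdir]
    refine iSup_le fun q => ?_
    obtain ⟨t, ht, hqt⟩ := q.2
    exact (lintegral_mono_set (Ioc_subset_Ioc_right hqt)).trans (h t ht)
  have hnull : volume ({0} ∪ {s | s ∈ S ∧ ∀ t ∈ S, t ≤ s}) = 0 := by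
    have hsub : {s | s ∈ S ∧ ∀ t ∈ S, t ≤ s}.Subsingleton := fun s hs t ht =>
      le_antisymm (ht.2 s hs.1) (hs.2 t ht.1)
    exact measure_union_null (measure_singleton _) (hsub.measure_zero _)
  refine le_trans (lintegral_mono' (Measure.restrict_mono_ae ?_) le_rfl) hU
  filter_upwards [measure_eq_zero_iff_ae_notMem.mp hnull] with s hs hsS
  have h0 : s ≠ 0 := fun h => hs (Or.inl h)
  have h1 : ∃ t ∈ S, s < t := by
    by_contra! hc
    exact hs (Or.inr ⟨hsS, hc⟩)
  obtain ⟨t, ht, hst⟩ := h1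
  obtain ⟨q, hq, hqt⟩ := exists_rat_btwn hst
  exact mem_iUnion.mpr ⟨⟨q, t, ht, hqt.le⟩, lt_of_le_of_ne (hS hsS) h0.symm, hq.le⟩

/-! ### Distance estimates and the L₂ gain along solutions -/

namespace PlantData

variable {nz ny nw nq ns np : ℕ} (p : PlantData nz ny nw nq ns np)
  {ℓ lam γ δ χ T₁ T₂ : ℝ} {P₁ : Matrix (Fin nz) (Fin nz) ℝ} {P₂ : Matrix (Fin ny) (Fin ny) ℝ}
  {J : Matrix (Fin nz) (Fin ny) ℝ} {Y : Matrix (Fin ny) (Fin ny) ℝ}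

/-- The distance to the target decays exponentially up to a multiple of the size of the input. -/
theorem exists_infDist_solution_le
    (hψ : ∀ v₁ v₂ : Vec nq, ‖p.ψ v₁ - p.ψ v₂‖ ≤ ℓ * ‖v₁ - v₂‖)
    (hT₁ : 0 < T₁) (hT₁₂ : T₁ ≤ T₂) (hlam : 0 < lam)
    (hP₁ : P₁.PosDef) (hP₂ : P₂.PosDef) (hδ : 0 < δ) (hχ : 0 < χ)
    (hLMI₀ : (-p.lmiMatrix ℓ lam γ δ χ 1 P₁ P₂ J Y).PosSemidef)
    (hLMI₂ : (-p.lmiMatrix ℓ lam γ δ χ (Real.exp (δ * T₂)) P₁ P₂ J Y).PosSemidef) :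
    ∃ κ > 0, ∃ κ' ≥ 0, ∀ φ u, (p.withObserver T₁ T₂ (P₁⁻¹ * J)
          (P₂⁻¹ * Y.transpose - p.C * (P₁⁻¹ * J))).IsSolutionPair φ u → ∀ r ≥ 0,
      (∀ j, ∀ᵐ t ∂(volume.restrict (φ.slice j)), ‖(u.val t j).fst‖ ≤ r) →
      (∀ t j, (t, j) ∈ φ.dom → (t, j + 1) ∈ φ.dom → ‖(u.val t j).snd‖ ≤ r) →
      ∀ t j, (t, j) ∈ φ.dom → Metric.infDist (φ.val t j) (p.target T₂) ≤
        κ * Real.exp (-lam * t) * Metric.infDist (φ.val 0 0) (p.target T₂) + κ' * r := by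
  obtain ⟨K, hK, h⟩ := p.exists_lyap_solution_le hψ hT₁ hT₁₂ hlam hP₁ hP₂ hδ hχ hLMI₀ hLMI₂
  obtain ⟨c₁, hc₁, h₁⟩ := p.exists_infDist_sq_le (T₂ := T₂) hP₁ hP₂ hδ
  obtain ⟨c₂, hc₂, h₂⟩ := p.exists_lyap_le hδ (hT₁.le.trans hT₁₂) P₁ P₂
  refine ⟨√(c₁ * c₂), by positivity, √(c₁ * K), by positivity, ?_⟩
  intro φ u hsol r hr hw hη t j ht
  have e₁ := h₁ _ (timer_mem hT₁ hT₁₂ hsol ht)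
  have e₂ := h₂ _ (timer_mem hT₁ hT₁₂ hsol φ.isDomain.zero_mem)
  have e₃ := h φ u hsol r hw hη t j ht
  set d := Metric.infDist (φ.val t j) (p.target T₂)
  set d₀ := Metric.infDist (φ.val 0 0) (p.target T₂)
  have hd₀ : 0 ≤ d₀ := Metric.infDist_nonneg
  have hexp : Real.exp (-(2 * lam) * t) = Real.exp (-lam * t) ^ 2 := by
    rw [← Real.exp_nat_mul]; congr 1; push_cast; ring
  -- Squares are compared: the cross term in the square of the right-hand side is nonnegative and is
  -- given away.
  refine le_of_sq_le_sq ?_ (by positivity)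
  have s₁ : √(c₁ * c₂) ^ 2 = c₁ * c₂ := Real.sq_sqrt (by positivity)
  have s₂ : √(c₁ * K) ^ 2 = c₁ * K := Real.sq_sqrt (by positivity)
  have hcross : 0 ≤ √(c₁ * c₂) * Real.exp (-lam * t) * d₀ * (√(c₁ * K) * r) := by positivity
  calc d ^ 2 ≤ c₁ * (Real.exp (-lam * t) ^ 2 * (c₂ * d₀ ^ 2) + K * r ^ 2) := by
        rw [hexp] at e₃
        refine e₁.trans (mul_le_mul_of_nonneg_left (e₃.trans ?_) hc₁.le)
        gcongr
    _ = √(c₁ * c₂) ^ 2 * Real.exp (-lam * t) ^ 2 * d₀ ^ 2 + √(c₁ * K) ^ 2 * r ^ 2 := by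
        rw [s₁, s₂]; ring
    _ ≤ _ := by linarith

/-- The dissipation inequality, integrated along a solution. -/
theorem lintegral_perfOutput_le (hψ : ∀ v₁ v₂ : Vec nq, ‖p.ψ v₁ - p.ψ v₂‖ ≤ ℓ * ‖v₁ - v₂‖)
    (hT₁ : 0 < T₁) (hT₁₂ : T₁ ≤ T₂) (hlam : 0 < lam)
    (hP₁ : P₁.PosDef) (hP₂ : P₂.PosDef) (hδ : 0 < δ) (hχ : 0 < χ)
    (hLMI₀ : (-p.lmiMatrix ℓ lam γ δ χ 1 P₁ P₂ J Y).PosSemidef)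
    (hLMI₂ : (-p.lmiMatrix ℓ lam γ δ χ (Real.exp (δ * T₂)) P₁ P₂ J Y).PosSemidef)
    {φ : HybridSignal (ObsState nz ny)} {u : HybridSignal (InputPair (Vec nw) (Vec ny))}
    (h : (p.withObserver T₁ T₂ (P₁⁻¹ * J)
          (P₂⁻¹ * Y.transpose - p.C * (P₁⁻¹ * J))).IsSolutionPair φ u)
    (hη : ∀ t j, (t, j) ∈ u.dom → (u.val t j).snd = 0) :
    ∫⁻ s in φ.domT, ENNReal.ofReal (‖p.perfOutput (φ.val s (φ.jmin s))‖ ^ 2) ≤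
      ENNReal.ofReal (p.lyap P₁ P₂ δ (φ.val 0 0)) +
        ∫⁻ s in u.domT, ENNReal.ofReal (γ ^ 2 * ‖(u.val s (u.jmin s)).fst‖ ^ 2) := by
  have hT : u.domT = φ.domT := by simp only [HybridSignal.domT, h.dom_eq]
  have hj : u.jmin = φ.jmin := by ext t; simp only [HybridSignal.jmin, h.dom_eq]
  rw [hT, hj]
  set f : ℝ → ℝ≥0∞ := fun s => ENNReal.ofReal (‖p.perfOutput (φ.val s (φ.jmin s))‖ ^ 2)
  set g : ℝ → ℝ≥0∞ := fun s => ENNReal.ofReal (γ ^ 2 * ‖(u.val s (φ.jmin s)).fst‖ ^ 2)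
  have key : ∀ {t : ℝ} {j : ℕ}, (t, j) ∈ φ.dom →
      ENNReal.ofReal (p.lyap P₁ P₂ δ (φ.val t j)) + ∫⁻ s in Ioc 0 t, f s ≤
        ENNReal.ofReal (p.lyap P₁ P₂ δ (φ.val 0 0)) + ∫⁻ s in Ioc 0 t, g s := by
    intro t j ht
    refine φ.isDomain.induction (P := fun t j =>
      ENNReal.ofReal (p.lyap P₁ P₂ δ (φ.val t j)) + ∫⁻ s in Ioc 0 t, f s ≤
        ENNReal.ofReal (p.lyap P₁ P₂ δ (φ.val 0 0)) + ∫⁻ s in Ioc 0 t, g s) ?_ ?_ ?_ ht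
    · simp
    · intro j a b hab ha hb ih
      have h0a := φ.isDomain.nonneg ha
      have hsub := φ.Icc_subset_slice ha hb
      have hac := arc_contDiff_comp h (p.contDiff_lyap P₁ P₂ δ) j a b hab hsub
      have step := hac.ofReal_add_lintegral_le (f := f) (g := g) hab
        (fun t => (p.lyap_nonneg hP₁ hP₂ _).2.2) ?_
      · have hu : ∀ k : ℝ → ℝ≥0∞, ∫⁻ s in Ioc 0 b, k s =
            (∫⁻ s in Ioc 0 a, k s) + ∫⁻ s in Ioc a b, k s := fun k => by
          rw [← Ioc_union_Ioc_eq_Ioc h0a hab,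
            lintegral_union measurableSet_Ioc (Ioc_disjoint_Ioc_of_le le_rfl)]
        rw [hu f, hu g]
        calc _ = (ENNReal.ofReal (p.lyap P₁ P₂ δ (φ.val b j)) + ∫⁻ s in Ioc a b, f s)
              + ∫⁻ s in Ioc 0 a, f s := by ring
          _ ≤ (ENNReal.ofReal (p.lyap P₁ P₂ δ (φ.val a j)) + ∫⁻ s in Ioc a b, g s)
              + ∫⁻ s in Ioc 0 a, f s := by gcongr
          _ = (ENNReal.ofReal (p.lyap P₁ P₂ δ (φ.val a j)) + ∫⁻ s in Ioc 0 a, f s)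
              + ∫⁻ s in Ioc a b, g s := by ring
          _ ≤ (ENNReal.ofReal (p.lyap P₁ P₂ δ (φ.val 0 0)) + ∫⁻ s in Ioc 0 a, g s)
              + ∫⁻ s in Ioc a b, g s := by gcongr
          _ = _ := by ring
      · filter_upwards [ae_mono (Measure.restrict_mono (Ioc_subset_Icc_self.trans hsub) le_rfl)
          (h.flow j), ae_restrict_mem measurableSet_Ioc] with t hx htab
        have htj : (t, j) ∈ φ.dom := hsub (Ioc_subset_Icc_self htab)
        obtain ⟨d, hd', hd⟩ := p.exists_hasDerivAt_lyap hψ hP₁ hP₂ hδ hχ hLMI₀ hLMI₂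
          (timer_mem hT₁ hT₁₂ h htj) hx
        refine ⟨d, hd, ?_⟩
        simp only [f, g, φ.jmin_eq ha htj htab.1]
        refine ENNReal.ofReal_add_le_of_add_le (by positivity) (by positivity) ?_
        -- The decay term -2λ_t V is nonpositive and is discarded; only the supply rate γ²|w|² -
        -- |y_p|² is integrated.
        have := mul_nonneg (show 0 ≤ 2 * lam by positivity)
          (p.lyap_nonneg (δ := δ) hP₁ hP₂ (φ.val t j)).2.2
        linarith
    · intro t j ht ht' ih
      refine le_trans ?_ ih
      have := p.lyap_jump_le hP₁ hP₂ hδ (h.jump t j ht ht').2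
      -- Without measurement noise V does not increase at jumps, which have zero length in ordinary
      -- time and contribute nothing to the integrals.
      rw [hη t j (h.dom_eq ▸ ht), norm_zero] at this
      gcongr
      simpa using this
  refine setLIntegral_le_of_forall_Ioc (fun t ht => φ.isDomain.nonneg ht.choose_spec) ?_
  rintro t ⟨j, ht⟩
  refine le_self_add.trans ((add_comm _ _).le.trans ((key ht).trans ?_))
  gcongr
  exact fun s hs => φ.isDomain.exists_mem_of_le ht hs.1.le hs.2

/-- Take square roots in the integrated dissipation inequality, using V(φ(0,0)) ≤ c d² and the
subadditivity of x ↦ x^(1/2). Working in `ℝ≥0∞` includes disturbances of infinite norm. -/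
theorem isL2Stable (hψ : ∀ v₁ v₂ : Vec nq, ‖p.ψ v₁ - p.ψ v₂‖ ≤ ℓ * ‖v₁ - v₂‖)
    (hT₁ : 0 < T₁) (hT₁₂ : T₁ ≤ T₂) (hlam : 0 < lam) (hγ : 0 < γ)
    (hP₁ : P₁.PosDef) (hP₂ : P₂.PosDef) (hδ : 0 < δ) (hχ : 0 < χ)
    (hLMI₀ : (-p.lmiMatrix ℓ lam γ δ χ 1 P₁ P₂ J Y).PosSemidef)
    (hLMI₂ : (-p.lmiMatrix ℓ lam γ δ χ (Real.exp (δ * T₂)) P₁ P₂ J Y).PosSemidef) :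
    (p.withObserver T₁ T₂ (P₁⁻¹ * J) (P₂⁻¹ * Y.transpose - p.C * (P₁⁻¹ * J))).IsL2Stable
      p.perfOutput (p.target T₂) γ := by
  obtain ⟨c, hc, hV⟩ := p.exists_lyap_le hδ (hT₁.le.trans hT₁₂) P₁ P₂
  refine ⟨√c, by positivity, fun φ u h hη => ?_⟩
  have key := p.lintegral_perfOutput_le hψ hT₁ hT₁₂ hlam hP₁ hP₂ hδ hχ hLMI₀ hLMI₂ h hη
  have hL : ∀ {F : Type} [NormedAddCommGroup F] (k : ℝ → F) (S : Set ℝ),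
      eLpNorm k 2 (volume.restrict S) =
        (∫⁻ s in S, ENNReal.ofReal (‖k s‖ ^ 2)) ^ (1 / 2 : ℝ) := by
    intro F _ k S
    rw [eLpNorm_eq_lintegral_rpow_enorm_toReal (by norm_num) (by norm_num)]
    simp only [ENNReal.toReal_ofNat, ENNReal.rpow_ofNat]
    congr 1
    refine lintegral_congr fun s => ?_
    rw [ENNReal.ofReal_pow (norm_nonneg _), ofReal_norm]
  rw [hL, hL]
  set d := Metric.infDist (φ.val 0 0) (p.target T₂)
  have hd : 0 ≤ d := Metric.infDist_nonneg
  have e₁ : ENNReal.ofReal (p.lyap P₁ P₂ δ (φ.val 0 0)) ≤ ENNReal.ofReal (√c * d) ^ (2 : ℝ) := by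
    rw [ENNReal.ofReal_rpow_of_nonneg (by positivity) (by norm_num)]
    refine ENNReal.ofReal_le_ofReal ((hV _ (timer_mem hT₁ hT₁₂ h φ.isDomain.zero_mem)).trans ?_)
    rw [Real.rpow_two, mul_pow, Real.sq_sqrt hc.le]
  have e₂ : ∫⁻ s in u.domT, ENNReal.ofReal (γ ^ 2 * ‖(u.val s (u.jmin s)).fst‖ ^ 2) =
      ENNReal.ofReal γ ^ (2 : ℝ) *
        ∫⁻ s in u.domT, ENNReal.ofReal (‖(u.val s (u.jmin s)).fst‖ ^ 2) := by
    rw [← lintegral_const_mul' _ _ (ENNReal.rpow_ne_top_of_nonneg (by norm_num)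
      ENNReal.ofReal_ne_top)]
    refine lintegral_congr fun s => ?_
    rw [ENNReal.ofReal_mul (by positivity), ENNReal.ofReal_rpow_of_nonneg hγ.le (by norm_num),
      Real.rpow_two]
  rw [e₂] at key
  have hsq : ∀ x : ℝ≥0∞, (x ^ (2 : ℝ)) ^ (1 / 2 : ℝ) = x := fun x => by
    rw [← ENNReal.rpow_mul]; norm_num
  calc _ ≤ (ENNReal.ofReal (√c * d) ^ (2 : ℝ) + ENNReal.ofReal γ ^ (2 : ℝ) *
        ∫⁻ s in u.domT, ENNReal.ofReal (‖(u.val s (u.jmin s)).fst‖ ^ 2)) ^ (1 / 2 : ℝ) :=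
        ENNReal.rpow_le_rpow (key.trans (by gcongr)) (by norm_num)
    _ ≤ _ := ENNReal.rpow_add_le_add_rpow _ _ (by norm_num) (by norm_num)
    _ = _ := by rw [ENNReal.mul_rpow_of_nonneg _ _ (by norm_num), hsq, hsq]

end PlantData

/-! ### Absolutely continuous curves with bounded derivative, and local solutions -/

section Curves

variable {E : Type*} [NormedAddCommGroup E] [InnerProductSpace ℝ E] {f : ℝ → E} {a b : ℝ}

/-- Pairing f with the fixed vector v = f(b) - f(a) reduces the estimate to a scalar monotonicity
statement. -/
theorem AbsolutelyContinuousOnInterval.norm_sub_le_of_ae_hasDerivAt {M : ℝ}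
    (hf : AbsolutelyContinuousOnInterval f a b) (hab : a ≤ b)
    (hd : ∀ᵐ t ∂(volume.restrict (Icc a b)), ∃ d, ‖d‖ ≤ M ∧ HasDerivAt f d t) :
    ‖f b - f a‖ ≤ M * (b - a) := by
  set v := f b - f a with hv
  rcases hab.eq_or_lt with rfl | hlt
  · simp [hv]
  have hinner : ContDiff ℝ 1 (fun x : E => inner ℝ v x) := contDiff_const.inner ℝ contDiff_id
  have hlin : AbsolutelyContinuousOnInterval (fun t : ℝ => M * ‖v‖ * t) a b :=
    ContDiff.contDiffOn (by fun_prop) |>.absolutelyContinuousOnInterval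
  have key := ((hf.contDiff_comp hinner).sub hlin).le_of_ae_hasDerivAt_nonpos hab ?_
  · have key : inner ℝ v (f b) - M * ‖v‖ * b ≤ inner ℝ v (f a) - M * ‖v‖ * a := key
    have h : ‖v‖ * ‖v‖ ≤ ‖v‖ * (M * (b - a)) := by
      rw [← real_inner_self_eq_norm_mul_norm]
      nth_rewrite 2 [hv]
      rw [inner_sub_right]
      linarith
    -- If v = 0 the claim needs M ≥ 0, which follows from the existence of one derivative value on a
    -- set of positive measure.
    rcases (norm_nonneg v).eq_or_lt with h0 | h0
    · rw [← h0]
      have : (volume.restrict (Icc a b)) ≠ 0 := by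
        simp [Measure.restrict_eq_zero, hlt]
      have := ae_neBot.mpr this
      obtain ⟨t, d, hdM, -⟩ := hd.exists
      exact mul_nonneg ((norm_nonneg d).trans hdM) (by linarith)
    · exact le_of_mul_le_mul_left h h0
  · filter_upwards [hd] with t ⟨d, hdM, hd⟩
    refine ⟨inner ℝ v d - M * ‖v‖, ?_, ?_⟩
    · have := (real_inner_le_norm v d).trans (mul_le_mul_of_nonneg_left hdM (norm_nonneg v))
      linarith
    · have h₁ : HasDerivAt (fun t => inner ℝ v (f t)) (inner ℝ v d) t := by
        simpa using (hasDerivAt_const t v).inner ℝ hd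
      have h₂ : HasDerivAt (fun t : ℝ => M * ‖v‖ * t) (M * ‖v‖) t := by
        simpa using (hasDerivAt_id t).const_mul (M * ‖v‖)
      exact h₁.sub h₂

/-- A curve with at most linear growth of the derivative is bounded on bounded intervals. -/
theorem AbsolutelyContinuousOnInterval.norm_sq_le_of_ae_hasDerivAt {K : ℝ} (hK : 0 ≤ K)
    (hf : AbsolutelyContinuousOnInterval f a b) (hab : a ≤ b)
    (hd : ∀ᵐ t ∂(volume.restrict (Icc a b)), ∃ d, ‖d‖ ≤ K * (1 + ‖f t‖) ∧ HasDerivAt f d t) :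
    ‖f b‖ ^ 2 ≤ Real.exp (3 * K * (b - a)) * (1 + ‖f a‖ ^ 2) := by
  have hsq : ContDiff ℝ 1 (fun x : E => 1 + ‖x‖ ^ 2) := contDiff_const.add (contDiff_norm_sq ℝ)
  have hexp : AbsolutelyContinuousOnInterval (fun r : ℝ => Real.exp (-(3 * K) * r)) a b :=
    ContDiff.contDiffOn (by fun_prop) |>.absolutelyContinuousOnInterval
  have key := (hexp.mul (hf.contDiff_comp hsq)).le_of_ae_hasDerivAt_nonpos hab ?_
  · have key : Real.exp (-(3 * K) * b) * (1 + ‖f b‖ ^ 2)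
      ≤ Real.exp (-(3 * K) * a) * (1 + ‖f a‖ ^ 2) := key
    calc ‖f b‖ ^ 2 ≤ 1 + ‖f b‖ ^ 2 := by linarith
      _ = Real.exp (3 * K * b) * (Real.exp (-(3 * K) * b) * (1 + ‖f b‖ ^ 2)) := by
          rw [← mul_assoc, ← Real.exp_add]; simp
      _ ≤ Real.exp (3 * K * b) * (Real.exp (-(3 * K) * a) * (1 + ‖f a‖ ^ 2)) := by gcongr
      _ = _ := by rw [← mul_assoc, ← Real.exp_add]; congr 2; ring
  · filter_upwards [hd] with t ⟨d, hdK, hd⟩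
    have h₁ : HasDerivAt (fun r => Real.exp (-(3 * K) * r))
        (Real.exp (-(3 * K) * t) * -(3 * K)) t := by
      simpa using ((hasDerivAt_id t).const_mul (-(3 * K))).exp
    have h₂ : HasDerivAt (fun r => 1 + ‖f r‖ ^ 2) (2 * inner ℝ (f t) d) t :=
      (hd.norm_sq).const_add 1
    refine ⟨_, ?_, h₁.mul h₂⟩
    have h₃ : inner ℝ (f t) d ≤ ‖f t‖ * (K * (1 + ‖f t‖)) :=
      (real_inner_le_norm _ _).trans (mul_le_mul_of_nonneg_left hdK (norm_nonneg _))
    -- The 3 comes from 2x(1 + x) ≤ 3(1 + x²).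
    have h₄ : 2 * inner ℝ (f t) d ≤ 3 * K * (1 + ‖f t‖ ^ 2) := by
      nlinarith [mul_nonneg hK (sq_nonneg (‖f t‖ - 1)), mul_nonneg hK (sq_nonneg ‖f t‖)]
    have h₅ := mul_le_mul_of_nonneg_left h₄ (Real.exp_pos (-(3 * K) * t)).le
    linarith

/-- A curve on `[a, b)` with at most linear growth of the derivative extends to a Lipschitz
curve. -/
theorem exists_lipschitzWith_eqOn_Ico [FiniteDimensional ℝ E] {K : ℝ} (hK : 0 ≤ K)
    (hf : ∀ s t, a ≤ s → s ≤ t → t < b → AbsolutelyContinuousOnInterval f s t)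
    (hd : ∀ᵐ t ∂(volume.restrict (Ico a b)), ∃ d, ‖d‖ ≤ K * (1 + ‖f t‖) ∧ HasDerivAt f d t) :
    ∃ (C : NNReal) (g : ℝ → E), LipschitzWith C g ∧ EqOn f g (Ico a b) := by
  -- The Gronwall bound makes f bounded, hence its derivative bounded, hence f Lipschitz on the
  -- half-open interval.
  obtain ⟨B, hB⟩ : ∃ B, ∀ t ∈ Ico a b, ‖f t‖ ≤ B := by
    refine ⟨√(Real.exp (3 * K * (b - a)) * (1 + ‖f a‖ ^ 2)), fun t ht => Real.le_sqrt_of_sq_le ?_⟩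
    have hsub : Icc a t ⊆ Ico a b := Icc_subset_Ico_right ht.2
    refine ((hf a t le_rfl ht.1 ht.2).norm_sq_le_of_ae_hasDerivAt hK ht.1
      (ae_mono (Measure.restrict_mono hsub le_rfl) hd)).trans ?_
    gcongr
    exact ht.2.le
  have hlip : LipschitzOnWith (K * (1 + B)).toNNReal f (Ico a b) := by
    have hlt : ∀ s t, a ≤ s → s ≤ t → t < b → dist (f s) (f t) ≤ K * (1 + B) * dist s t := by
      intro s t has hst htb
      have hsub : Icc s t ⊆ Ico a b := fun r hr => ⟨has.trans hr.1, hr.2.trans_lt htb⟩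
      rw [dist_comm, dist_comm s, dist_eq_norm, Real.dist_eq, abs_of_nonneg (by linarith)]
      refine (hf s t has hst htb).norm_sub_le_of_ae_hasDerivAt hst ?_
      filter_upwards [ae_mono (Measure.restrict_mono hsub le_rfl) hd,
        ae_restrict_mem measurableSet_Icc] with r ⟨d, hdK, hd⟩ hr
      refine ⟨d, hdK.trans ?_, hd⟩
      gcongr
      exact hB r (hsub hr)
    refine LipschitzOnWith.of_dist_le_mul fun s hs t ht => ?_
    have hle : K * (1 + B) ≤ ((K * (1 + B)).toNNReal : ℝ) := Real.le_coe_toNNReal _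
    rcases le_total s t with hst | hst
    · exact (hlt s t hs.1 hst ht.2).trans (by gcongr)
    · rw [dist_comm, dist_comm s]
      exact (hlt t s ht.1 hst hs.2).trans (by gcongr)
  obtain ⟨g, hg, hfg⟩ := hlip.extend_finite_dimension
  exact ⟨_, g, hg, hfg⟩

end Curves

theorem LipschitzWith.exists_local_solution {E : Type*} [NormedAddCommGroup E] [NormedSpace ℝ E]
    [CompleteSpace E] {F : E → E} {K : NNReal} (hF : LipschitzWith K F) (x₀ : E) (b : ℝ) {ε : ℝ}
    (hε : 0 < ε) :
    ∃ h > 0, h ≤ ε ∧ ∃ α : ℝ → E, α b = x₀ ∧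
      AbsolutelyContinuousOnInterval α b (b + h) ∧
      ∀ t ∈ Ioo b (b + h), HasDerivAt α (F (α t)) t := by
  -- M bounds F on the unit ball around x₀, and a time span of at most 1/(M + 1) keeps the solution
  -- in that ball.
  set M : NNReal := ‖F x₀‖₊ + K with hM
  set h : ℝ := min ε (1 / (M + 1)) with hh
  have hpos : 0 < h := lt_min hε (by positivity)
  have hPL : IsPicardLindelof (fun _ => F) (tmin := b) (tmax := b + h)
      ⟨b, le_rfl, by linarith⟩ x₀ 1 0 M K := by
    refine IsPicardLindelof.of_time_independent (fun x hx => ?_) hF.lipschitzOnWith ?_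
    · have h₁ : ‖F x - F x₀‖ ≤ K * 1 := by
        rw [← dist_eq_norm]
        refine (hF.dist_le_mul _ _).trans ?_
        gcongr
        simpa using hx
      have h₂ := norm_le_norm_add_norm_sub' (F x) (F x₀)
      rw [hM]
      push_cast
      linarith
    · have h₁ : h ≤ 1 / (M + 1) := min_le_right _ _
      rw [le_div_iff₀ (by positivity)] at h₁
      simp only [add_sub_cancel_left, sub_self, NNReal.coe_one, NNReal.coe_zero, sub_zero,
        max_eq_left hpos.le]
      linarith
  obtain ⟨α, hα₀, hα⟩ := hPL.exists_eq_forall_mem_Icc_hasDerivWithinAt₀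
  have hcont : ContinuousOn α (Icc b (b + h)) := fun t ht => (hα t ht).continuousWithinAt
  obtain ⟨B, hB⟩ := isCompact_Icc.exists_bound_of_continuousOn
    (hF.continuous.comp_continuousOn hcont)
  refine ⟨h, hpos, min_le_left _ _, α, hα₀, ?_, fun t ht =>
    (hα t (Ioo_subset_Icc_self ht)).hasDerivAt (Icc_mem_nhds ht.1 ht.2)⟩
  have hlip : LipschitzOnWith B.toNNReal α (Icc b (b + h)) :=
    (convex_Icc _ _).lipschitzOnWith_of_nnnorm_hasDerivWithin_le hα fun t ht => by
      rw [← norm_toNNReal]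
      exact Real.toNNReal_le_toNNReal (hB t ht)
  rw [← uIcc_of_le (by linarith : b ≤ b + h)] at hlip
  exact hlip.absolutelyContinuousOnInterval

/-! ### Extension of hybrid time domains -/

/-- A bounded domain has finitely many slices and a bounded last one, either closed or half-open. A
closed last slice may be lengthened or followed by a one-point slice; a half-open one may be closed.
-/
theorem IsHybridTimeDomain.exists_extension {D : Set (ℝ × ℕ)} (hD : IsHybridTimeDomain D)
    (hbdd : ¬ ∀ M : ℝ, ∃ p ∈ D, M ≤ p.1 + p.2) :
    ∃ (J : ℕ) (a b : ℝ), (∀ j, J < j → ∀ t, (t, j) ∉ D) ∧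
      ((a ≤ b ∧ {t | (t, J) ∈ D} = Icc a b ∧
          (∀ c ≥ b, IsHybridTimeDomain (D ∪ Icc a c ×ˢ {J})) ∧
          IsHybridTimeDomain (D ∪ {(b, J + 1)})) ∨
        (a < b ∧ {t | (t, J) ∈ D} = Ico a b ∧ IsHybridTimeDomain (D ∪ Icc a b ×ˢ {J}))) := by
  obtain ⟨t, h0, hmono, rfl | ⟨J, last, hlast, rfl⟩⟩ := hD
  · refine absurd (fun M => ?_) hbdd
    obtain ⟨n, hn⟩ := exists_nat_ge M
    refine ⟨(t n, n), ⟨le_rfl, hmono (Nat.le_succ _)⟩, hn.trans ?_⟩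
    have := hmono (Nat.zero_le n)
    simp only
    linarith
  have hgrow : ∀ c ≥ t J, IsHybridTimeDomain
      {p : ℝ × ℕ | (p.2 < J ∧ p.1 ∈ Icc (t p.2) (t (p.2 + 1))) ∨ (p.2 = J ∧ p.1 ∈ Icc (t J) c)} := by
    intro c hc
    refine ⟨fun n => if n ≤ J then t n else c, by simp [h0], fun m n hmn => ?_, Or.inr
      ⟨J, _, Or.inl rfl, ?_⟩⟩
    · simp only
      split_ifs with h₁ h₂ h₂
      · exact hmono hmn
      · exact (hmono h₁).trans hc
      · omega
      · exact le_rfl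
    · ext ⟨s, i⟩
      simp only [mem_ofPred_eq]
      refine or_congr (and_congr_right fun hi => ?_) (and_congr_right fun hi => ?_)
      · simp [hi.le, Nat.succ_le_of_lt hi]
      · simp
  have hout : ∀ (S : Set ℝ) j, J < j → ∀ s, (s, j) ∉ {p : ℝ × ℕ |
      (p.2 < J ∧ p.1 ∈ Icc (t p.2) (t (p.2 + 1))) ∨ (p.2 = J ∧ p.1 ∈ S)} := by
    rintro S j hj s (⟨h, -⟩ | ⟨h, -⟩) <;> simp only at h <;> omega
  have hslice : ∀ S : Set ℝ, {s | (s, J) ∈ {p : ℝ × ℕ |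
      (p.2 < J ∧ p.1 ∈ Icc (t p.2) (t (p.2 + 1))) ∨ (p.2 = J ∧ p.1 ∈ S)}} = S := by
    intro S
    ext s
    simp
  have hunion : ∀ S S' : Set ℝ, S ⊆ S' → {p : ℝ × ℕ |
      (p.2 < J ∧ p.1 ∈ Icc (t p.2) (t (p.2 + 1))) ∨ (p.2 = J ∧ p.1 ∈ S)} ∪ S' ×ˢ {J} =
      {p : ℝ × ℕ | (p.2 < J ∧ p.1 ∈ Icc (t p.2) (t (p.2 + 1))) ∨ (p.2 = J ∧ p.1 ∈ S')} := by
    intro S S' hSS'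
    ext ⟨s, i⟩
    have := @hSS' s
    simp only [mem_union, mem_ofPred_eq, mem_prod, mem_singleton_iff]
    tauto
  rcases hlast with rfl | ⟨hlt, rfl⟩ | rfl
  · refine ⟨J, t J, t (J + 1), hout _, Or.inl ⟨hmono (Nat.le_succ _), hslice _, fun c hc => ?_, ?_⟩⟩
    · rw [hunion _ _ (Icc_subset_Icc_right hc)]
      exact hgrow c ((hmono (Nat.le_succ _)).trans hc)
    · refine ⟨fun n => if n ≤ J + 1 then t n else t (J + 1), by simp [h0], fun m n hmn => ?_, Or.inr
        ⟨J + 1, _, Or.inl rfl, ?_⟩⟩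
      · simp only
        split_ifs with h₁ h₂ h₂
        · exact hmono hmn
        · exact hmono h₁
        · omega
        · exact le_rfl
      · ext ⟨s, i⟩
        simp only [mem_union, mem_ofPred_eq, mem_singleton_iff, Prod.mk.injEq]
        rcases lt_trichotomy i J with hi | rfl | hi
        · simp [hi, hi.ne, show i ≠ J + 1 by omega, show i < J + 1 by omega, show i ≤ J by omega,
            show i ≤ J + 1 by omega]
        · simp
        · rcases eq_or_ne i (J + 1) with rfl | hne
          · simp
          · simp [hi.ne', hi.not_gt, hne, show ¬ i < J + 1 by omega]
  · refine ⟨J, t J, t (J + 1), hout _, Or.inr ⟨hlt, hslice _, ?_⟩⟩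
    rw [hunion _ _ Ico_subset_Icc_self]
    exact hgrow _ hlt.le
  · refine absurd (fun M => ?_) hbdd
    refine ⟨(max M (t J), J), Or.inr ⟨rfl, mem_Ici.mpr (le_max_right _ _)⟩, ?_⟩
    have : (0 : ℝ) ≤ J := Nat.cast_nonneg _
    have := le_max_left M (t J)
    simp only
    linarith

/-! ### Extension of solution pairs -/

namespace HybridSignal

open Classical in
/-- The extension of a hybrid signal to a larger domain by zero. -/
def extendZero {E : Type*} [Zero E] (u : HybridSignal E) (D : Set (ℝ × ℕ))
    (hD : IsHybridTimeDomain D) : HybridSignal E :=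
  ⟨D, fun t j => if (t, j) ∈ u.dom then u.val t j else 0, hD⟩

/-- The restrictions of the signal to bounded time intervals are essentially bounded. -/
def IsBoundedInput {E : Type*} [Norm E] (u : HybridSignal E) : Prop :=
  ∀ (j : ℕ) (T : ℝ), ∃ M : ℝ, ∀ᵐ t ∂(volume.restrict (u.slice j)), t ≤ T → ‖u.val t j‖ ≤ M

/-- Local boundedness alone would not suffice: in the larger domain a compact set may reach the
missing endpoint of a half-open slice, so a bound up to that endpoint is needed. -/
theorem IsInput.extendZero {E : Type*} [NormedAddCommGroup E] [MeasurableSpace E]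
    {u : HybridSignal E} (hu : u.IsInput) (hb : u.IsBoundedInput) {D : Set (ℝ × ℕ)}
    (hD : IsHybridTimeDomain D) : (u.extendZero D hD).IsInput := by
  classical
  intro j
  constructor
  · have h₁ : AEMeasurable ((u.slice j).indicator fun t => u.val t j) volume :=
      (aemeasurable_indicator_iff (u.measurableSet_slice j)).mpr (hu j).1
    refine h₁.restrict.congr (Filter.Eventually.of_forall fun t => ?_)
    by_cases ht : (t, j) ∈ u.dom
    · have : t ∈ u.slice j := ht
      simp [HybridSignal.extendZero, ht, this]
    · have : t ∉ u.slice j := ht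
      simp [HybridSignal.extendZero, ht, this]
  · intro K _ hK
    obtain ⟨T, hT⟩ := hK.bddAbove
    obtain ⟨M, hM⟩ := hb j T
    rw [ae_restrict_iff' (u.measurableSet_slice j)] at hM
    refine ⟨max M 0, ?_⟩
    rw [ae_restrict_iff' hK.measurableSet]
    filter_upwards [hM] with t ht htK
    by_cases htj : (t, j) ∈ u.dom
    · simpa [HybridSignal.extendZero, htj] using Or.inl (ht htj (hT htK))
    · simp [HybridSignal.extendZero, htj]

end HybridSignal

namespace HybridSystem

variable {X W N : Type*} [NormedAddCommGroup X] [NormedSpace ℝ X]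
  [NormedAddCommGroup W] [MeasurableSpace W] [NormedAddCommGroup N] [MeasurableSpace N]
  {S : HybridSystem X W N} {φ : HybridSignal X} {u : HybridSignal (InputPair W N)}

/-- Extension of a solution pair in a single slice `k` of the domain. -/
theorem IsSolutionPair.extend (h : S.IsSolutionPair φ u) (hb : u.IsBoundedInput)
    {D : Set (ℝ × ℕ)} (hD : IsHybridTimeDomain D) (hsub : φ.dom ⊆ D) (ψ : ℝ → ℕ → X) (k : ℕ)
    (hval : ∀ t j, (t, j) ∈ φ.dom → ψ t j = φ.val t j)
    (hk : ∀ j, j ≠ k → ∀ t, (t, j) ∈ D → (t, j) ∈ φ.dom)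
    (harc : ∀ a b, a ≤ b → (∀ t ∈ Icc a b, (t, k) ∈ D) →
      AbsolutelyContinuousOnInterval (fun t => ψ t k) a b)
    (hmem : ∀ t ∈ interior {t | (t, k) ∈ D}, ψ t k ∈ S.flowSet)
    (hflow : ∀ᵐ t ∂(volume.restrict {t | (t, k) ∈ D}), HasDerivAt (fun s => ψ s k)
      (S.flowMap (ψ t k) ((u.extendZero D hD).val t k).fst) t)
    (hjump : ∀ t j, (t, j) ∈ D → (t, j + 1) ∈ D → (t, j) ∈ φ.dom ∧ ((t, j + 1) ∈ φ.dom ∨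
      (ψ t j ∈ S.jumpSet ∧ ψ t (j + 1) ∈ S.jumpMap (ψ t j) (u.val t j).snd))) :
    S.IsSolutionPair ⟨D, ψ, hD⟩ (u.extendZero D hD) := by
  classical
  have hval_u : ∀ t j, (t, j) ∈ φ.dom → (u.extendZero D hD).val t j = u.val t j :=
    fun t j ht => if_pos (h.dom_eq ▸ ht)
  have hslice : ∀ j, j ≠ k → {t | (t, j) ∈ D} = φ.slice j := fun j hj =>
    Set.ext fun t => ⟨hk j hj t, fun ht => hsub ht⟩
  have hmeas : ∀ j, MeasurableSet (φ.slice j) := φ.measurableSet_slice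
  refine ⟨?_, h.input.extendZero hb hD, rfl, ?_, ?_, ?_, ?_⟩
  · intro j a b hab hj
    rcases eq_or_ne j k with rfl | hjk
    · exact harc a b hab fun t ht => hj ht
    · have hj' : Icc a b ⊆ φ.slice j := hj.trans (hslice j hjk).subset
      refine (h.arc j a b hab hj').congr_eqOn fun t ht => ?_
      rw [uIcc_of_le hab] at ht
      exact (hval t j (hj' ht)).symm
  · have := hval 0 0 φ.isDomain.zero_mem
    simp only [this]
    exact h.init
  · intro j t ht
    rcases eq_or_ne j k with rfl | hjk
    · exact hmem t ht
    · have ht' : t ∈ interior (φ.slice j) := (hslice j hjk) ▸ ht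
      have htj : (t, j) ∈ φ.dom := (interior_subset ht' : t ∈ φ.slice j)
      have := h.flow_mem j t ht'
      rwa [← hval t j htj] at this
  · intro j
    rcases eq_or_ne j k with rfl | hjk
    · exact hflow
    · have hs : (⟨D, ψ, hD⟩ : HybridSignal X).slice j = φ.slice j := hslice j hjk
      rw [hs]
      filter_upwards [h.flow j, φ.ae_mem_interior_slice j] with t ht hti
      have htj : (t, j) ∈ φ.dom := (interior_subset hti : t ∈ φ.slice j)
      have heq : (fun s => ψ s j) =ᶠ[nhds t] fun s => φ.val s j := by
        filter_upwards [mem_interior_iff_mem_nhds.mp hti] with s hs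
        exact hval s j hs
      simp only [hval t j htj, hval_u t j htj]
      exact ht.congr_of_eventuallyEq heq
  · intro t j ht ht'
    obtain ⟨htj, h'⟩ := hjump t j ht ht'
    simp only [hval_u t j htj]
    rcases h' with h' | h'
    · simp only [hval t j htj, hval t (j + 1) h']
      exact h.jump t j htj h'
    · exact h'

theorem IsMaximalIn.false_of_extend {𝒰 : Set (HybridSignal (InputPair W N))}
    (h : S.IsMaximalIn 𝒰 φ u) {D : Set (ℝ × ℕ)} {hD : IsHybridTimeDomain D} (hsub : φ.dom ⊆ D)
    {ψ : ℝ → ℕ → X} (hval : ∀ t j, (t, j) ∈ φ.dom → ψ t j = φ.val t j)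
    (hsol : S.IsSolutionPair ⟨D, ψ, hD⟩ (u.extendZero D hD)) (hu : u.extendZero D hD ∈ 𝒰)
    {q : ℝ × ℕ} (hq : q ∈ D) (hq' : q ∉ φ.dom) : False := by
  refine hq' ((h.2.2 _ _ hsol hu hsub fun t j ht => ⟨hval t j ht, ?_⟩) ▸ hq)
  exact if_pos (h.1.dom_eq ▸ ht)

end HybridSystem

namespace PlantData

variable {nz ny nw nq ns np : ℕ} (p : PlantData nz ny nw nq ns np)
  {ℓ T₁ T₂ : ℝ} {L : Matrix (Fin nz) (Fin ny) ℝ} {H : Matrix (Fin ny) (Fin ny) ℝ}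
  {φ : HybridSignal (ObsState nz ny)} {u : HybridSignal (InputPair (Vec nw) (Vec ny))}

theorem exists_norm_drift_sub_le (hℓ : 0 < ℓ)
    (hψ : ∀ v₁ v₂ : Vec nq, ‖p.ψ v₁ - p.ψ v₂‖ ≤ ℓ * ‖v₁ - v₂‖) :
    ∃ K ≥ 0, ∀ z z' : Vec nz, ‖p.drift z - p.drift z'‖ ≤ K * ‖z - z'‖ := by
  refine ⟨‖p.A.actL‖ + ‖p.B.actL‖ * (ℓ * ‖p.S.actL‖), by positivity, fun z z' => ?_⟩
  have e : p.drift z - p.drift z' = p.A.act (z - z') +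
      p.B.act (p.ψ (p.S.act z) - p.ψ (p.S.act z')) := by
    rw [drift, drift, Matrix.act_vec_sub, Matrix.act_vec_sub]; abel
  have h₁ : ‖p.ψ (p.S.act z) - p.ψ (p.S.act z')‖ ≤ ℓ * (‖p.S.actL‖ * ‖z - z'‖) := by
    refine (hψ _ _).trans ?_
    rw [← Matrix.act_vec_sub]
    gcongr
    exact Matrix.norm_act_le _ _
  calc ‖p.drift z - p.drift z'‖
      ≤ ‖p.A.act (z - z')‖ + ‖p.B.act (p.ψ (p.S.act z) - p.ψ (p.S.act z'))‖ := by
        rw [e]; exact norm_add_le _ _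
    _ ≤ ‖p.A.actL‖ * ‖z - z'‖ + ‖p.B.actL‖ * (ℓ * (‖p.S.actL‖ * ‖z - z'‖)) := by
        gcongr
        · exact Matrix.norm_act_le _ _
        · exact (Matrix.norm_act_le _ _).trans (by gcongr)
    _ = _ := by ring

theorem _root_.ObsState.norm_mk_le (z zhat : Vec nz) (θ : Vec ny) (τ : ℝ) :
    ‖ObsState.mk z zhat θ τ‖ ≤ ‖z‖ + ‖zhat‖ + ‖θ‖ + ‖τ‖ := by
  refine le_of_sq_le_sq ?_ (by positivity)
  rw [ObsState.norm_mk_sq]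
  have h₁ := norm_nonneg z
  have h₂ := norm_nonneg zhat
  have h₃ := norm_nonneg θ
  have h₄ := norm_nonneg τ
  nlinarith [mul_nonneg h₁ h₂, mul_nonneg h₁ h₃, mul_nonneg h₁ h₄, mul_nonneg h₂ h₃,
    mul_nonneg h₂ h₄, mul_nonneg h₃ h₄]

theorem _root_.ObsState.norm_coord_le (x : ObsState nz ny) :
    ‖x.z‖ ≤ ‖x‖ ∧ ‖x.zhat‖ ≤ ‖x‖ ∧ ‖x.θ‖ ≤ ‖x‖ :=
  ⟨WithLp.norm_fst_le _ _, (WithLp.norm_fst_le _ _).trans (WithLp.norm_snd_le _ _),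
    ((WithLp.norm_fst_le _ _).trans (WithLp.norm_snd_le _ _)).trans (WithLp.norm_snd_le _ _)⟩

/-- Only the zero disturbance matters here, since inputs are extended by zero. -/
theorem exists_lipschitzWith_flowMap (hℓ : 0 < ℓ)
    (hψ : ∀ v₁ v₂ : Vec nq, ‖p.ψ v₁ - p.ψ v₂‖ ≤ ℓ * ‖v₁ - v₂‖) :
    ∃ K : NNReal, LipschitzWith K fun x => (p.withObserver T₁ T₂ L H).flowMap x 0 := by
  obtain ⟨K, hK, hd⟩ := p.exists_norm_drift_sub_le hℓ hψ
  refine ⟨(K + (K + ‖L.actL‖) + ‖H.actL‖).toNNReal, LipschitzWith.of_dist_le_mul fun x y => ?_⟩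
  rw [Real.coe_toNNReal _ (by positivity), dist_eq_norm, dist_eq_norm]
  have e : (p.withObserver T₁ T₂ L H).flowMap x 0 - (p.withObserver T₁ T₂ L H).flowMap y 0 =
      ObsState.mk ((p.drift x.z + p.N.act 0) - (p.drift y.z + p.N.act 0))
        ((p.drift x.zhat + L.act x.θ) - (p.drift y.zhat + L.act y.θ))
        (H.act x.θ - H.act y.θ) (-1 - -1) := rfl
  obtain ⟨h₁, h₂, h₃⟩ := ObsState.norm_coord_le (x - y)
  rw [e]
  refine (ObsState.norm_mk_le _ _ _ _).trans ?_
  rw [add_sub_add_right_eq_sub, add_sub_add_comm, ← Matrix.act_vec_sub, ← Matrix.act_vec_sub,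
    sub_self, norm_zero, add_zero]
  have f₁ : ‖p.drift x.z - p.drift y.z‖ ≤ K * ‖x - y‖ := (hd _ _).trans (by gcongr; exact h₁)
  have f₂ : ‖p.drift x.zhat - p.drift y.zhat + L.act (x.θ - y.θ)‖ ≤
      (K + ‖L.actL‖) * ‖x - y‖ := by
    refine (norm_add_le _ _).trans ?_
    rw [add_mul]
    exact add_le_add ((hd _ _).trans (by gcongr; exact h₂))
      ((Matrix.norm_act_le _ _).trans (by gcongr; exact h₃))
  have f₃ : ‖H.act (x.θ - y.θ)‖ ≤ ‖H.actL‖ * ‖x - y‖ :=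
    (Matrix.norm_act_le _ _).trans (by gcongr; exact h₃)
  linarith

theorem exists_norm_flowMap_le (hℓ : 0 < ℓ)
    (hψ : ∀ v₁ v₂ : Vec nq, ‖p.ψ v₁ - p.ψ v₂‖ ≤ ℓ * ‖v₁ - v₂‖) (M : ℝ) :
    ∃ K ≥ 0, ∀ x w, ‖w‖ ≤ M →
      ‖(p.withObserver T₁ T₂ L H).flowMap x w‖ ≤ K * (1 + ‖x‖) := by
  obtain ⟨K, hK⟩ := p.exists_lipschitzWith_flowMap (T₁ := T₁) (T₂ := T₂) (L := L) (H := H) hℓ hψ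
  set F := fun x => (p.withObserver T₁ T₂ L H).flowMap x 0 with hF
  refine ⟨K + ‖F 0‖ + ‖p.N.actL‖ * |M|, by positivity, fun x w hw => ?_⟩
  have e : (p.withObserver T₁ T₂ L H).flowMap x w = F x + ObsState.mk (p.N.act w) 0 0 0 := by
    have : F x + ObsState.mk (p.N.act w) 0 0 0 = ObsState.mk
      (p.drift x.z + p.N.act 0 + p.N.act w) (p.drift x.zhat + L.act x.θ + 0) (H.act x.θ + 0)
        (-1 + 0) := rfl
    have h0 : p.N.act 0 = 0 := map_zero _
    rw [this, h0, add_zero, add_zero, add_zero, add_zero]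
    rfl
  have h₁ : ‖F x‖ ≤ ‖F 0‖ + K * ‖x‖ := by
    have := hK.dist_le_mul x 0
    rw [dist_eq_norm, dist_zero_right] at this
    exact (norm_le_norm_add_norm_sub' (F x) (F 0)).trans (by gcongr)
  have h₂ : ‖ObsState.mk (ny := ny) (p.N.act w) 0 0 0‖ ≤ ‖p.N.actL‖ * |M| := by
    refine (ObsState.norm_mk_le _ _ _ _).trans ?_
    simp only [norm_zero, add_zero]
    exact (Matrix.norm_act_le _ _).trans (by gcongr; exact hw.trans (le_abs_self M))
  rw [e]
  refine (norm_add_le _ _).trans ((add_le_add h₁ h₂).trans ?_)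
  have hx := norm_nonneg x
  have g₁ : 0 ≤ ‖F 0‖ * ‖x‖ := by positivity
  have g₂ : 0 ≤ ‖p.N.actL‖ * |M| * ‖x‖ := by positivity
  have g₃ : (0 : ℝ) ≤ K := K.2
  linarith

end PlantData

/-! ### Extending solutions, and completeness of maximal solutions -/

namespace PlantData

variable {nz ny nw nq ns np : ℕ} (p : PlantData nz ny nw nq ns np)
  {ℓ T₁ T₂ : ℝ} {L : Matrix (Fin nz) (Fin ny) ℝ} {H : Matrix (Fin ny) (Fin ny) ℝ}
  {φ : HybridSignal (ObsState nz ny)} {u : HybridSignal (InputPair (Vec nw) (Vec ny))}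

/-- A solution on a half-open last interval extends to the right end point. -/
theorem exists_extension_endpoint (hℓ : 0 < ℓ)
    (hψ : ∀ v₁ v₂ : Vec nq, ‖p.ψ v₁ - p.ψ v₂‖ ≤ ℓ * ‖v₁ - v₂‖)
    (h : (p.withObserver T₁ T₂ L H).IsSolutionPair φ u) (hb : u.IsBoundedInput) {J : ℕ} {a b : ℝ}
    (hab : a < b) (hout : ∀ j, J < j → ∀ t, (t, j) ∉ φ.dom)
    (hslice : {t | (t, J) ∈ φ.dom} = Ico a b)
    (hD : IsHybridTimeDomain (φ.dom ∪ Icc a b ×ˢ {J})) :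
    ∃ ψ : ℝ → ℕ → ObsState nz ny, (∀ t j, (t, j) ∈ φ.dom → ψ t j = φ.val t j) ∧
      (p.withObserver T₁ T₂ L H).IsSolutionPair ⟨_, ψ, hD⟩ (u.extendZero _ hD) := by
  classical
  have hin : ∀ t, (t, J) ∈ φ.dom ↔ t ∈ Ico a b := fun t => by rw [← hslice]; rfl
  have hslice' : {t | (t, J) ∈ φ.dom ∪ Icc a b ×ˢ {J}} = Icc a b := by
    ext t
    simp only [mem_ofPred_eq, mem_union, hin, mem_prod, mem_singleton_iff, and_true]
    exact ⟨fun h => h.elim (fun h => Ico_subset_Icc_self h) id, Or.inr⟩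
  have hflow : ∀ᵐ t ∂(volume.restrict (Ico a b)), HasDerivAt (fun s => φ.val s J)
      ((p.withObserver T₁ T₂ L H).flowMap (φ.val t J) (u.val t J).fst) t := by
    rw [← hslice]; exact h.flow J
  obtain ⟨M, hM⟩ := hb J b
  obtain ⟨K, hK, hgrowth⟩ := p.exists_norm_flowMap_le (T₁ := T₁) (T₂ := T₂) (L := L) (H := H)
    hℓ hψ M
  have hM' : ∀ᵐ t ∂(volume.restrict (Ico a b)), t ≤ b → ‖u.val t J‖ ≤ M := by
    have : u.slice J = Ico a b := by rw [← hslice, h.dom_eq]; rfl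
    rwa [this] at hM
  obtain ⟨C, g, hg, hfg⟩ := exists_lipschitzWith_eqOn_Ico (f := fun t => φ.val t J) (a := a)
    (b := b) hK
    (fun s t has hst htb => h.arc J s t hst fun r hr =>
      (hin r).mpr ⟨has.trans hr.1, hr.2.trans_lt htb⟩) (by
      filter_upwards [hflow, hM', ae_restrict_mem measurableSet_Ico] with t ht htM htab
      exact ⟨_, hgrowth _ _ ((WithLp.norm_fst_le _ _).trans (htM htab.2.le)), ht⟩)
  set ψ : ℝ → ℕ → ObsState nz ny := fun t j => if t = b ∧ j = J then g b else φ.val t j with hψ'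
  have hval : ∀ t j, (t, j) ∈ φ.dom → ψ t j = φ.val t j := by
    intro t j ht
    refine if_neg ?_
    rintro ⟨rfl, rfl⟩
    exact ((hin t).mp ht).2.false
  have hψg : ∀ t ∈ Icc a b, ψ t J = g t := by
    intro t ht
    rcases ht.2.eq_or_lt with rfl | hlt
    · simp [hψ']
    · rw [hval t J ((hin t).mpr ⟨ht.1, hlt⟩)]
      exact hfg ⟨ht.1, hlt⟩
  refine ⟨ψ, hval, h.extend hb hD subset_union_left ψ J hval ?_ ?_ ?_ ?_ ?_⟩
  · rintro j hj t (ht | ht)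
    · exact ht
    · exact absurd ht.2 hj
  · intro c d hcd hsub
    refine (hg.lipschitzOnWith (s := uIcc c d)).absolutelyContinuousOnInterval.congr_eqOn ?_
    intro t ht
    rw [uIcc_of_le hcd] at ht
    exact (hψg t (hslice'.subset (hsub t ht))).symm
  · rw [hslice', interior_Icc]
    intro t ht
    rw [hval t J ((hin t).mpr (Ioo_subset_Ico_self ht))]
    refine h.flow_mem J t ?_
    have : φ.slice J = Ico a b := hslice
    rw [this, interior_Ico]
    exact ht
  · rw [hslice', ← restrict_Ico_eq_restrict_Icc]
    -- The derivatives are two-sided, so the left endpoint is excluded in order to have a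
    -- neighbourhood on which ψ equals the old arc.
    have hne : ∀ᵐ t ∂(volume.restrict (Ico a b)), t ≠ a :=
      ae_restrict_of_ae (measure_eq_zero_iff_ae_notMem.mp (measure_singleton a))
    filter_upwards [hflow, ae_restrict_mem measurableSet_Ico, hne] with t ht htab hta
    have htj := (hin t).mpr htab
    have hu : (u.extendZero _ hD).val t J = u.val t J := if_pos (h.dom_eq ▸ htj)
    rw [hu, hval t J htj]
    refine ht.congr_of_eventuallyEq ?_
    filter_upwards [Ioo_mem_nhds (lt_of_le_of_ne htab.1 (Ne.symm hta)) htab.2] with s hs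
    exact hval s J ((hin s).mpr (Ioo_subset_Ico_self hs))
  · rintro t j ht ht'
    have ha : (a, J) ∈ φ.dom := (hin a).mpr ⟨le_rfl, hab⟩
    have hj : (t, j + 1) ∈ φ.dom ∪ Icc a b ×ˢ {J} → j < J := by
      rintro (h' | h')
      · by_contra hc
        exact hout _ (by omega) _ h'
      · have : j + 1 = J := h'.2
        omega
    have hjJ := hj ht'
    have htφ : (t, j) ∈ φ.dom := ht.elim id fun h' => absurd h'.2 (by simp; omega)
    refine ⟨htφ, Or.inl (ht'.elim id fun h' => ?_)⟩
    have h₁ : j + 1 = J := h'.2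
    -- A jump into slice J cannot occur after a, so the added endpoint b creates no new jump.
    have h₂ := φ.isDomain.le_of_lt htφ ha hjJ
    rw [h₁]
    exact (hin t).mpr ⟨h'.1.1, lt_of_le_of_lt h₂ hab⟩

/-- A solution on a closed last interval extends by a flow if its timer has not expired. -/
theorem exists_extension_flow (hℓ : 0 < ℓ)
    (hψ : ∀ v₁ v₂ : Vec nq, ‖p.ψ v₁ - p.ψ v₂‖ ≤ ℓ * ‖v₁ - v₂‖) (hT₁ : 0 < T₁) (hT₁₂ : T₁ ≤ T₂)
    (h : (p.withObserver T₁ T₂ L H).IsSolutionPair φ u) (hb : u.IsBoundedInput) {J : ℕ} {a b : ℝ}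
    (hab : a ≤ b) (hout : ∀ j, J < j → ∀ t, (t, j) ∉ φ.dom)
    (hslice : {t | (t, J) ∈ φ.dom} = Icc a b)
    (hD : ∀ c ≥ b, IsHybridTimeDomain (φ.dom ∪ Icc a c ×ˢ {J}))
    (hτ : 0 < (φ.val b J).τ) :
    ∃ c, ∃ hc : b < c, ∃ ψ : ℝ → ℕ → ObsState nz ny,
      (∀ t j, (t, j) ∈ φ.dom → ψ t j = φ.val t j) ∧
      (p.withObserver T₁ T₂ L H).IsSolutionPair ⟨_, ψ, hD c hc.le⟩
        (u.extendZero _ (hD c hc.le)) := by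
  classical
  have hin : ∀ t, (t, J) ∈ φ.dom ↔ t ∈ Icc a b := fun t => by rw [← hslice]; rfl
  have haJ : (a, J) ∈ φ.dom := (hin a).mpr (left_mem_Icc.mpr hab)
  have hbJ : (b, J) ∈ φ.dom := (hin b).mpr (right_mem_Icc.mpr hab)
  obtain ⟨K, hF⟩ := p.exists_lipschitzWith_flowMap (T₁ := T₁) (T₂ := T₂) (L := L) (H := H) hℓ hψ
  -- The remaining timer value is passed as the bound on the duration, so the timer cannot become
  -- negative along α.
  obtain ⟨d, hd, hdτ, α, hα₀, hαac, hα⟩ := hF.exists_local_solution (φ.val b J) b hτ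
  have hbd : b < b + d := by linarith
  refine ⟨b + d, hbd, ?_⟩
  set c := b + d with hc_def
  have hτα : ∀ t ∈ Icc b c, (α t).τ ∈ Icc 0 T₂ := by
    intro t ht
    have hsub : uIcc b t ⊆ uIcc b c := by
      rw [uIcc_of_le ht.1, uIcc_of_le hbd.le]; exact Icc_subset_Icc_right ht.2
    have hac := (hαac.mono hsub).contDiff_comp
      (ContinuousLinearMap.contDiff (ObsState.τL (nz := nz) (ny := ny)) (n := 1))
    have hlin : AbsolutelyContinuousOnInterval (fun t : ℝ => t) b t :=
      contDiffOn_id.absolutelyContinuousOnInterval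
    have hder : ∀ᵐ s ∂(volume.restrict (Icc b t)),
        HasDerivAt (fun s => ObsState.τL (α s)) (-1) s := by
      rw [← restrict_Ioo_eq_restrict_Icc]
      filter_upwards [ae_restrict_mem measurableSet_Ioo] with s hs
      exact hasDerivAt_timer (p := p) (w := 0) (hα s ⟨hs.1, hs.2.trans_le ht.2⟩)
    -- τ is nonincreasing, which keeps it below T₂; next, t + τ is nondecreasing, which keeps τ
    -- nonnegative up to c.
    have h₁ := hac.le_of_ae_hasDerivAt_nonpos ht.1
      (hder.mono fun s hs => ⟨-1, by norm_num, hs⟩)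
    have h₂ := ((hlin.add hac).neg).le_of_ae_hasDerivAt_nonpos ht.1
      (hder.mono fun s hs => ⟨-(1 + -1), by norm_num, ((hasDerivAt_id s).add hs).neg⟩)
    have h₂ : -(t + ObsState.τL (α t)) ≤ -(b + ObsState.τL (α b)) := h₂
    have hb' := (timer_mem hT₁ hT₁₂ h hbJ).2
    have e : ObsState.τL (α b) = (φ.val b J).τ := by rw [hα₀]; rfl
    rw [e] at h₁ h₂
    refine ⟨?_, h₁.trans hb'⟩
    have : (0 : ℝ) ≤ ObsState.τL (α t) := by linarith [ht.2]
    exact this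
  have hslice' : {t | (t, J) ∈ φ.dom ∪ Icc a c ×ˢ {J}} = Icc a c := by
    ext t
    simp only [mem_ofPred_eq, mem_union, hin, mem_prod, mem_singleton_iff, and_true]
    exact ⟨fun h => h.elim (fun h => Icc_subset_Icc_right hbd.le h) id, Or.inr⟩
  set ψ : ℝ → ℕ → ObsState nz ny := fun t j => if t ≤ b ∨ j ≠ J then φ.val t j else α t with hψ'
  have hval : ∀ t j, (t, j) ∈ φ.dom → ψ t j = φ.val t j := by
    intro t j ht
    refine if_pos ?_
    by_cases hj : j = J
    · subst hj; exact Or.inl ((hin t).mp ht).2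
    · exact Or.inr hj
  have hψα : ∀ t, b < t → ψ t J = α t := fun t ht => if_neg (by simpa using ht)
  have hψφ : ∀ t ≤ b, ψ t J = φ.val t J := fun t ht => if_pos (Or.inl ht)
  have hac : AbsolutelyContinuousOnInterval (fun t => ψ t J) a c := by
    have hφ := h.arc J a b hab fun t ht => (hin t).mpr ht
    refine (hφ.glue hαac hab hbd.le hα₀.symm).congr_eqOn fun t _ => ?_
    by_cases ht : t ≤ b
    · simp [ht, hψφ t ht]
    · simp [ht, hψα t (not_le.mp ht)]
  refine ⟨ψ, hval, h.extend hb (hD c hbd.le) subset_union_left ψ J hval ?_ ?_ ?_ ?_ ?_⟩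
  · rintro j hj t (ht | ht)
    · exact ht
    · exact absurd ht.2 hj
  · intro r s hrs hsub
    refine hac.mono fun t ht => ?_
    rw [uIcc_of_le hrs] at ht
    rw [uIcc_of_le (hab.trans hbd.le)]
    exact hslice'.subset (hsub t ht)
  · rw [hslice', interior_Icc]
    intro t ht
    rcases le_or_gt t b with htb | htb
    · rw [hψφ t htb]
      exact timer_mem hT₁ hT₁₂ h ((hin t).mpr ⟨ht.1.le, htb⟩)
    · rw [hψα t htb]
      exact hτα t ⟨htb.le, ht.2.le⟩
  · rw [hslice', ae_restrict_iff' measurableSet_Icc]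
    have hflow := h.flow J
    rw [ae_restrict_iff' (φ.measurableSet_slice J)] at hflow
    have hne : ∀ r : ℝ, ∀ᵐ t : ℝ, t ≠ r := fun r =>
      measure_eq_zero_iff_ae_notMem.mp (measure_singleton r)
    filter_upwards [hflow, hne a, hne b, hne c] with t ht hta htb htc htac
    rcases lt_or_gt_of_ne htb with hlt | hgt
    · have htj := (hin t).mpr ⟨htac.1, hlt.le⟩
      have hu : (u.extendZero _ (hD c hbd.le)).val t J = u.val t J := if_pos (h.dom_eq ▸ htj)
      rw [hu, hval t J htj]
      refine (ht htj).congr_of_eventuallyEq ?_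
      filter_upwards [Iio_mem_nhds hlt] with s hs
      exact hψφ s (mem_Iio.mp hs).le
    · have htj : (t, J) ∉ u.dom := by
        rw [← h.dom_eq, hin]; exact fun h' => h'.2.not_gt hgt
      have hu : (u.extendZero _ (hD c hbd.le)).val t J = 0 := if_neg htj
      rw [hu, hψα t hgt]
      refine (hα t ⟨hgt, lt_of_le_of_ne htac.2 htc⟩).congr_of_eventuallyEq ?_
      filter_upwards [Ioi_mem_nhds hgt] with s hs
      exact hψα s hs
  · rintro t j ht ht'
    have hjJ : j < J := by
      rcases ht' with h' | h'
      · by_contra hc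
        exact hout _ (by omega) _ h'
      · have : j + 1 = J := h'.2
        omega
    have htφ : (t, j) ∈ φ.dom := ht.elim id fun h' => absurd h'.2 (by simp; omega)
    refine ⟨htφ, Or.inl (ht'.elim id fun h' => ?_)⟩
    have h₁ : j + 1 = J := h'.2
    have h₂ := φ.isDomain.le_of_lt htφ haJ hjJ
    rw [h₁]
    exact (hin t).mpr ⟨h'.1.1, h₂.trans hab⟩

/-- A solution on a closed last interval extends by a jump if its timer has expired. -/
theorem exists_extension_jump (hT₁₂ : T₁ ≤ T₂)
    (h : (p.withObserver T₁ T₂ L H).IsSolutionPair φ u) (hb : u.IsBoundedInput) {J : ℕ} {a b : ℝ}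
    (hab : a ≤ b) (hout : ∀ j, J < j → ∀ t, (t, j) ∉ φ.dom)
    (hslice : {t | (t, J) ∈ φ.dom} = Icc a b)
    (hD : IsHybridTimeDomain (φ.dom ∪ {(b, J + 1)}))
    (hτ : (φ.val b J).τ = 0) :
    ∃ ψ : ℝ → ℕ → ObsState nz ny, (∀ t j, (t, j) ∈ φ.dom → ψ t j = φ.val t j) ∧
      (p.withObserver T₁ T₂ L H).IsSolutionPair ⟨_, ψ, hD⟩ (u.extendZero _ hD) := by
  classical
  have hbJ : (b, J) ∈ φ.dom := by
    have : b ∈ {t | (t, J) ∈ φ.dom} := by rw [hslice]; exact right_mem_Icc.mpr hab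
    exact this
  obtain ⟨x', hx'⟩ : ∃ x', x' ∈ (p.withObserver T₁ T₂ L H).jumpMap (φ.val b J) (u.val b J).snd :=
    -- Any reset value in [T₁, T₂] would do.
    ⟨_, T₁, ⟨le_rfl, hT₁₂⟩, rfl⟩
  set ψ : ℝ → ℕ → ObsState nz ny := fun t j => if j = J + 1 then x' else φ.val t j with hψ'
  have hval : ∀ t j, (t, j) ∈ φ.dom → ψ t j = φ.val t j := by
    intro t j ht
    refine if_neg ?_
    rintro rfl
    exact hout _ (Nat.lt_succ_self J) t ht
  have hψ₁ : ∀ t, ψ t (J + 1) = x' := fun t => if_pos rfl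
  have hslice' : {t | (t, J + 1) ∈ φ.dom ∪ {(b, J + 1)}} = {b} := by
    ext t
    simp [hout (J + 1) (Nat.lt_succ_self J) t]
  refine ⟨ψ, hval, h.extend hb hD subset_union_left ψ (J + 1) hval ?_ ?_ ?_ ?_ ?_⟩
  · rintro j hj t (ht | ht)
    · exact ht
    · simp only [mem_singleton_iff, Prod.mk.injEq] at ht
      exact absurd ht.2 hj
  · intro c d _ _
    simp only [hψ₁]
    exact contDiffOn_const.absolutelyContinuousOnInterval
  · rw [hslice', interior_singleton]
    exact fun t ht => absurd ht (notMem_empty t)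
  · rw [hslice', Measure.restrict_singleton, measure_singleton, zero_smul]
    simp
  · rintro t j ht ht'
    rcases ht' with h' | h'
    · have htφ : (t, j) ∈ φ.dom := by
        rcases ht with ht | ht
        · exact ht
        · simp only [mem_singleton_iff, Prod.mk.injEq] at ht
          exact absurd h' (hout _ (by omega) _)
      exact ⟨htφ, Or.inl h'⟩
    · simp only [mem_singleton_iff, Prod.mk.injEq, add_left_inj] at h'
      obtain ⟨rfl, rfl⟩ := h'
      rw [hval t j hbJ, hψ₁]
      exact ⟨hbJ, Or.inr ⟨hτ, hx'⟩⟩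

/-- Maximal solution pairs with locally bounded inputs are complete. -/
theorem isComplete_of_isMaximalIn (hℓ : 0 < ℓ)
    (hψ : ∀ v₁ v₂ : Vec nq, ‖p.ψ v₁ - p.ψ v₂‖ ≤ ℓ * ‖v₁ - v₂‖) (hT₁ : 0 < T₁) (hT₁₂ : T₁ ≤ T₂)
    {𝒰 : Set (HybridSignal (InputPair (Vec nw) (Vec ny)))}
    (h : (p.withObserver T₁ T₂ L H).IsMaximalIn 𝒰 φ u) (hb : u.IsBoundedInput)
    (h𝒰 : ∀ D hD, u.extendZero D hD ∈ 𝒰) : φ.IsComplete := by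
  by_contra hnc
  obtain ⟨J, a, b, hout, ⟨hab, hslice, hDf, hDj⟩ | ⟨hab, hslice, hD⟩⟩ :=
    φ.isDomain.exists_extension hnc
  · have hin : ∀ t, (t, J) ∈ φ.dom ↔ t ∈ Icc a b := fun t => by rw [← hslice]; rfl
    have hbJ : (b, J) ∈ φ.dom := (hin b).mpr (right_mem_Icc.mpr hab)
    rcases (timer_mem hT₁ hT₁₂ h.1 hbJ).1.eq_or_lt with hτ | hτ
    · obtain ⟨ψ, hval, hsol⟩ := p.exists_extension_jump hT₁₂ h.1 hb hab hout hslice hDj hτ.symm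
      exact h.false_of_extend subset_union_left hval hsol (h𝒰 _ _) (Or.inr rfl)
        (hout _ (Nat.lt_succ_self J) b)
    · obtain ⟨c, hc, ψ, hval, hsol⟩ := p.exists_extension_flow hℓ hψ hT₁ hT₁₂ h.1 hb hab hout
        hslice hDf hτ
      refine h.false_of_extend subset_union_left hval hsol (h𝒰 _ _) (q := (c, J))
        (Or.inr ⟨⟨hab.trans hc.le, le_rfl⟩, rfl⟩) ?_
      rw [hin]
      exact fun h' => h'.2.not_gt hc
  · obtain ⟨ψ, hval, hsol⟩ := p.exists_extension_endpoint hℓ hψ h.1 hb hab hout hslice hD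
    refine h.false_of_extend subset_union_left hval hsol (h𝒰 _ _) (q := (b, J))
      (Or.inr ⟨⟨hab.le, le_rfl⟩, rfl⟩) fun h' => ?_
    have : b ∈ Ico a b := hslice.subset h'
    exact this.2.false

end PlantData

theorem HybridSignal.isBoundedInput_of_truncSupNorm_lt_top {E : Type*} [NormedAddCommGroup E]
    {u : HybridSignal E} (hu : ∀ T, u.truncSupNorm T < ∞) : u.IsBoundedInput := by
  intro j T
  refine ⟨(u.truncSupNorm (T + j)).toReal, ?_⟩
  filter_upwards [u.ae_enorm_le_truncSupNorm j (T + j)] with t ht htT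
  rw [← toReal_enorm]
  exact ENNReal.toReal_mono (hu _).ne (ht (by linarith))

namespace HybridSystem

theorem isBoundedInput_of_mem_zeroInputs {W N : Type*} [NormedAddCommGroup W]
    [NormedAddCommGroup N] {u : HybridSignal (InputPair W N)} (hu : u ∈ zeroInputs W N) :
    u.IsBoundedInput := by
  refine fun j T => ⟨0, ?_⟩
  filter_upwards [ae_restrict_mem (u.measurableSet_slice j)] with t ht _
  rw [hu t j ht, norm_zero]

variable {X W N : Type*} [NormedAddCommGroup X] [NormedSpace ℝ X]
  [NormedAddCommGroup W] [MeasurableSpace W] [NormedAddCommGroup N] [MeasurableSpace N]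
  {S S' : HybridSystem X W N} {φ : HybridSignal X} {u : HybridSignal (InputPair W N)}

/-- Solution pairs are transported by linear maps that intertwine two hybrid systems. -/
theorem IsSolutionPair.map (h : S.IsSolutionPair φ u) (f : X →L[ℝ] X)
    (hflowSet : ∀ x ∈ S.flowSet, f x ∈ S'.flowSet) (hjumpSet : ∀ x ∈ S.jumpSet, f x ∈ S'.jumpSet)
    (hflowMap : ∀ x w, f (S.flowMap x w) = S'.flowMap (f x) w)
    (hjumpMap : ∀ x η, ∀ x' ∈ S.jumpMap x η, f x' ∈ S'.jumpMap (f x) η) :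
    S'.IsSolutionPair (φ.map f) u where
  arc j a b hab hj := (h.arc j a b hab hj).contDiff_comp f.contDiff
  input := h.input
  dom_eq := h.dom_eq
  init := by
    rcases h.init with h0 | h0
    · exact Or.inl (show f (φ.val 0 0) ∈ closure S'.flowSet from
        map_mem_closure f.continuous h0 hflowSet)
    · exact Or.inr (hjumpSet _ h0)
  flow_mem j t ht := hflowSet _ (h.flow_mem j t ht)
  flow j := by
    have hs : (φ.map f).slice j = φ.slice j := rfl
    rw [hs]
    filter_upwards [h.flow j] with t ht
    have := f.hasFDerivAt.comp_hasDerivAt t ht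
    rw [hflowMap] at this
    exact this
  jump t j ht ht' := ⟨hjumpSet _ (h.jump t j ht ht').1, hjumpMap _ _ _ (h.jump t j ht ht').2⟩

end HybridSystem

/-! ### Stability conclusions -/

namespace PlantData

variable {nz ny nw nq ns np : ℕ} (p : PlantData nz ny nw nq ns np)
  {ℓ lam γ δ χ T₁ T₂ : ℝ} {P₁ : Matrix (Fin nz) (Fin nz) ℝ} {P₂ : Matrix (Fin ny) (Fin ny) ℝ}
  {J : Matrix (Fin nz) (Fin ny) ℝ} {Y : Matrix (Fin ny) (Fin ny) ℝ}
  {L : Matrix (Fin nz) (Fin ny) ℝ}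

theorem isGloballyExpStable (hℓ : 0 < ℓ)
    (hψ : ∀ v₁ v₂ : Vec nq, ‖p.ψ v₁ - p.ψ v₂‖ ≤ ℓ * ‖v₁ - v₂‖)
    (hT₁ : 0 < T₁) (hT₁₂ : T₁ ≤ T₂) (hlam : 0 < lam)
    (hP₁ : P₁.PosDef) (hP₂ : P₂.PosDef) (hδ : 0 < δ) (hχ : 0 < χ)
    (hLMI₀ : (-p.lmiMatrix ℓ lam γ δ χ 1 P₁ P₂ J Y).PosSemidef)
    (hLMI₂ : (-p.lmiMatrix ℓ lam γ δ χ (Real.exp (δ * T₂)) P₁ P₂ J Y).PosSemidef) :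
    (p.withObserver T₁ T₂ (P₁⁻¹ * J)
      (P₂⁻¹ * Y.transpose - p.C * (P₁⁻¹ * J))).IsGloballyExpStable (p.target T₂) lam := by
  classical
  refine ⟨fun φ u h => p.isComplete_of_isMaximalIn hℓ hψ hT₁ hT₁₂ h
    (HybridSystem.isBoundedInput_of_mem_zeroInputs h.2.1) fun D hD t j _ => ?_, ?_⟩
  · by_cases ht : (t, j) ∈ u.dom
    · exact (if_pos ht).trans (h.2.1 t j ht)
    · exact if_neg ht
  · obtain ⟨κ, hκ, κ', -, hle⟩ := p.exists_infDist_solution_le hψ hT₁ hT₁₂ hlam hP₁ hP₂ hδ hχ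
      hLMI₀ hLMI₂
    refine ⟨κ, hκ, fun φ u h hu t j ht => ?_⟩
    have hu' : ∀ t j, (t, j) ∈ φ.dom → u.val t j = 0 := fun t j ht => hu t j (h.dom_eq ▸ ht)
    -- For zero inputs the general estimate applies with r = 0.
    have := hle φ u h 0 le_rfl (fun j => ?_) (fun t j ht _ => ?_) t j ht
    · simpa using this
    · filter_upwards [ae_restrict_mem (φ.measurableSet_slice j)] with t ht
      simp [hu' t j ht]
    · simp [hu' t j ht]

theorem isExpISS (hℓ : 0 < ℓ)
    (hψ : ∀ v₁ v₂ : Vec nq, ‖p.ψ v₁ - p.ψ v₂‖ ≤ ℓ * ‖v₁ - v₂‖)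
    (hT₁ : 0 < T₁) (hT₁₂ : T₁ ≤ T₂) (hlam : 0 < lam)
    (hP₁ : P₁.PosDef) (hP₂ : P₂.PosDef) (hδ : 0 < δ) (hχ : 0 < χ)
    (hLMI₀ : (-p.lmiMatrix ℓ lam γ δ χ 1 P₁ P₂ J Y).PosSemidef)
    (hLMI₂ : (-p.lmiMatrix ℓ lam γ δ χ (Real.exp (δ * T₂)) P₁ P₂ J Y).PosSemidef) :
    (p.withObserver T₁ T₂ (P₁⁻¹ * J)
      (P₂⁻¹ * Y.transpose - p.C * (P₁⁻¹ * J))).IsExpISS (p.target T₂) := by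
  refine ⟨fun φ u h hu => p.isComplete_of_isMaximalIn hℓ hψ hT₁ hT₁₂ h
    (HybridSignal.isBoundedInput_of_truncSupNorm_lt_top hu) fun _ _ => mem_univ _, ?_⟩
  obtain ⟨κ, hκ, κ', hκ', hle⟩ := p.exists_infDist_solution_le hψ hT₁ hT₁₂ hlam hP₁ hP₂ hδ hχ
    hLMI₀ hLMI₂
  have hm : 0 < min 1 T₁ := lt_min one_pos hT₁
  -- The factors 2 convert the sum of the two terms into a maximum. The extra 1 makes the gain
  -- function strictly increasing even if κ' = 0.
  refine ⟨2 * κ * Real.exp (lam * T₂ / 2), by positivity, lam / 2 * min 1 T₁, by positivity,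
    fun r => (2 * κ' + 1) * r, by fun_prop, ?_, by simp, ?_⟩
  · intro r _ s _ hrs
    exact mul_lt_mul_of_pos_left hrs (by positivity)
  intro φ u h hu t j ht
  have hbound := hle φ u h u.supNorm.toReal ENNReal.toReal_nonneg (fun j => ?_)
    (fun t j ht ht' => ?_) t j ht
  · set d := Metric.infDist (φ.val t j) (p.target T₂)
    set d₀ := Metric.infDist (φ.val 0 0) (p.target T₂)
    set r := u.supNorm.toReal
    have hd₀ : 0 ≤ d₀ := Metric.infDist_nonneg
    have hr : 0 ≤ r := ENNReal.toReal_nonneg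
    have hexp : Real.exp (-lam * t) ≤
        Real.exp (lam * T₂ / 2) * Real.exp (-(lam / 2 * min 1 T₁) * (t + j)) := by
      rw [← Real.exp_add]
      refine Real.exp_le_exp.mpr ?_
      have hj := jumps_mul_le hT₁ hT₁₂ h ht
      have ht0 := φ.isDomain.nonneg ht
      have h₁ : min 1 T₁ * t ≤ 1 * t := by gcongr; exact min_le_left _ _
      have h₂ : min 1 T₁ * j ≤ T₁ * j := by gcongr; exact min_le_right _ _
      -- Since T₁ j ≤ t + T₂, this bounds hybrid time by ordinary time; half of the decay rate is
      -- spent on it, with cost e^(λ_t T₂/2).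
      have h₃ : min 1 T₁ * (t + j) ≤ 2 * t + T₂ := by linarith
      have h₄ := mul_le_mul_of_nonneg_left h₃ (show 0 ≤ lam / 2 by positivity)
      linarith
    have hA : κ * Real.exp (-lam * t) * d₀ ≤ κ * Real.exp (lam * T₂ / 2) *
        Real.exp (-(lam / 2 * min 1 T₁) * (t + j)) * d₀ := by
      rw [mul_assoc κ (Real.exp (lam * T₂ / 2))]
      gcongr
    rcases le_total (κ * Real.exp (-lam * t) * d₀) (κ' * r) with hc | hc
    · refine le_max_of_le_right ?_
      linarith
    · refine le_max_of_le_left ?_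
      linarith
  · have : φ.slice j = u.slice j := by simp only [HybridSignal.slice, h.dom_eq]
    rw [this]
    filter_upwards [u.ae_norm_le_supNorm hu j] with t ht
    exact (WithLp.norm_fst_le _ _).trans ht
  · exact (WithLp.norm_snd_le _ _).trans (u.norm_le_supNorm hu (h.dom_eq ▸ ht) (h.dom_eq ▸ ht'))

/-! ### The predictor-based observer -/

/-- The embedding of the output space as the third coordinate of the state. -/
def θEmbed : Vec ny →L[ℝ] ObsState nz ny :=
  LinearMap.toContinuousLinearMap
    { toFun := fun v => ObsState.mk 0 0 v 0
      map_add' := fun v w => by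
        have : ObsState.mk (0 : Vec nz) 0 v 0 + ObsState.mk 0 0 w 0
          = ObsState.mk (0 + 0) (0 + 0) (v + w) (0 + 0) := rfl
        rw [this, add_zero, add_zero]
      map_smul' := fun c v => by
        have : c • ObsState.mk (0 : Vec nz) 0 v 0 = ObsState.mk (c • 0) (c • 0) (c • v) (c • 0) :=
          rfl
        rw [RingHom.id_apply, this, smul_zero, smul_zero] }

/-- The linear change of coordinates `(z, ẑ, θ, τ) ↦ (z, ẑ, θ + M ẑ, τ)`. -/
def shear (M : Matrix (Fin ny) (Fin nz) ℝ) : ObsState nz ny →L[ℝ] ObsState nz ny :=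
  ContinuousLinearMap.id ℝ _ + θEmbed.comp (M.actL.comp ObsState.zhatL)

theorem shear_mk (M : Matrix (Fin ny) (Fin nz) ℝ) (z zhat : Vec nz) (θ : Vec ny) (τ : ℝ) :
    shear M (ObsState.mk z zhat θ τ) = ObsState.mk z zhat (θ + M.act zhat) τ := by
  have : shear M (ObsState.mk z zhat θ τ)
    = ObsState.mk (z + 0) (zhat + 0) (θ + M.act zhat) (τ + 0) := rfl
  rw [this, add_zero, add_zero, add_zero]

/-- With H = -CL and v = θ + Cẑ, the term C L θ in C ẑ' cancels H θ, so v' = C(Aẑ + Bψ(Sẑ)), and at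
samples v⁺ = (y - Cẑ) + Cẑ = y. The shear by -C inverts the shear by C, which gives the converse. -/
theorem isSolutionPair_withObserver_iff_withPredictor {φ : HybridSignal (ObsState nz ny)}
    {u : HybridSignal (InputPair (Vec nw) (Vec ny))} :
    (p.withObserver T₁ T₂ L (-(p.C * L))).IsSolutionPair φ u ↔
      (p.withPredictor T₁ T₂ L).IsSolutionPair (φ.map p.predictorCoord) u := by
  have hneg : ∀ v : Vec nz, (-p.C).act v = -p.C.act v := fun v => by simp [Matrix.act]
  have hgain : ∀ v : Vec ny, (-(p.C * L)).act v = -p.C.act (L.act v) := fun v => by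
    rw [← Matrix.act_mul]
    simp [Matrix.act]
  have hform : ∀ (M : Matrix (Fin ny) (Fin nz) ℝ) (x : ObsState nz ny),
      shear M x = ObsState.mk x.z x.zhat (x.θ + M.act x.zhat) x.τ :=
    fun M x => shear_mk M x.z x.zhat x.θ x.τ
  have hmap : φ.map p.predictorCoord = φ.map (shear p.C) := by
    have : p.predictorCoord = shear p.C := funext fun x => (shear_mk p.C x.z x.zhat x.θ x.τ).symm
    rw [this]
  have hinv : φ = (φ.map (shear p.C)).map (shear (-p.C)) := by
    have : ∀ x : ObsState nz ny, shear (-p.C) (shear p.C x) = x := fun x => by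
      have h₁ := shear_mk p.C x.z x.zhat x.θ x.τ
      have h₂ : ObsState.mk x.z x.zhat x.θ x.τ = x := rfl
      rw [← h₂, h₁, shear_mk, hneg, add_neg_cancel_right]
    simp only [HybridSignal.map, this]
  rw [hmap]
  refine ⟨fun h => ?_, fun h => ?_⟩
  · refine h.map (shear p.C) (fun x hx => ?_) (fun x hx => ?_) (fun x w => ?_) ?_
    · rw [hform]
      exact hx
    · rw [hform]
      exact hx
    · rw [hform _ x]
      refine (shear_mk _ _ _ _ _).trans ?_
      simp only [withPredictor, ObsState.mk, ObsState.z, ObsState.zhat, ObsState.θ,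
        hgain, Matrix.act_vec_add]
      simp
    · rintro x η _ ⟨v, hv, rfl⟩
      rw [hform _ x, shear_mk]
      exact ⟨v, hv, by simp [ObsState.z, ObsState.zhat, ObsState.mk]⟩
  · rw [hinv]
    refine h.map (shear (-p.C)) (fun x hx => ?_) (fun x hx => ?_) (fun x w => ?_) ?_
    · rw [hform]
      exact hx
    · rw [hform]
      exact hx
    · rw [hform _ x]
      refine (shear_mk _ _ _ _ _).trans ?_
      simp only [withObserver, ObsState.mk, ObsState.z, ObsState.zhat, ObsState.θ,
        hgain, hneg, Matrix.act_vec_add, ← sub_eq_add_neg]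
      simp
    · rintro x η _ ⟨v, hv, rfl⟩
      rw [hform _ x, shear_mk]
      exact ⟨v, hv, by simp [ObsState.z, ObsState.zhat, ObsState.mk, sub_eq_add_neg, hneg]⟩

end PlantData

end

theorem proposition2 {nz ny nw nq ns np : ℕ} (p : PlantData nz ny nw nq ns np)
    (ℓ : ℝ) (hℓ : 0 < ℓ) (hψ : ∀ v₁ v₂ : Vec nq, ‖p.ψ v₁ - p.ψ v₂‖ ≤ ℓ * ‖v₁ - v₂‖)
    (T₁ T₂ : ℝ) (hT₁ : 0 < T₁) (hT₁₂ : T₁ ≤ T₂)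
    (lam γ : ℝ) (hlam : 0 < lam) (hγ : 0 < γ)
    (P₁ : Matrix (Fin nz) (Fin nz) ℝ) (hP₁ : P₁.PosDef)
    (P₂ : Matrix (Fin ny) (Fin ny) ℝ) (hP₂ : P₂.PosDef)
    (δ χ : ℝ) (hδ : 0 < δ) (hχ : 0 < χ)
    (J : Matrix (Fin nz) (Fin ny) ℝ) (Y : Matrix (Fin ny) (Fin ny) ℝ)
    (hLMI₀ : (-p.lmiMatrix ℓ lam γ δ χ 1 P₁ P₂ J Y).PosSemidef)
    (hLMI₂ : (-p.lmiMatrix ℓ lam γ δ χ (Real.exp (δ * T₂)) P₁ P₂ J Y).PosSemidef) :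
    p.SolvesObserverProblem T₁ T₂ lam γ (P₁⁻¹ * J) (P₂⁻¹ * Y.transpose - p.C * (P₁⁻¹ * J)) ∧
    (Y = 0 → ∀ φ u,
      (p.withObserver T₁ T₂ (P₁⁻¹ * J)
          (P₂⁻¹ * Y.transpose - p.C * (P₁⁻¹ * J))).IsSolutionPair φ u ↔
        (p.withPredictor T₁ T₂ (P₁⁻¹ * J)).IsSolutionPair (φ.map p.predictorCoord) u) := by
  refine ⟨⟨p.isGloballyExpStable hℓ hψ hT₁ hT₁₂ hlam hP₁ hP₂ hδ hχ hLMI₀ hLMI₂,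
    p.isExpISS hℓ hψ hT₁ hT₁₂ hlam hP₁ hP₂ hδ hχ hLMI₀ hLMI₂,
    p.isL2Stable hψ hT₁ hT₁₂ hlam hγ hP₁ hP₂ hδ hχ hLMI₀ hLMI₂⟩, ?_⟩
  rintro rfl φ u
  -- For Y = 0 the gain H reduces to -CL.
  rw [Matrix.transpose_zero, Matrix.mul_zero, zero_sub]
  exact p.isSolutionPair_withObserver_iff_withPredictor
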